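/- Let $a_0,a_1\in(0,1)$ and $\lambda_0,\lambda_1>0$. Let $B,T\ge 0$ be random variables and $J^{(0)}\sim\exp(\lambda_0)$, $J^{(1)}\sim\exp(\lambda_1)$, where $(B,T)$, $J^{(0)}$, $J^{(1)}$ are independent. For $\mathrm{Re}\,s\ge 0$ put $$\chi(s)=E(e^{-sB}1(B<T)),\quad \psi(s)=E(e^{-sT}1(B\ge T)),\quad h_0(s)=\tfrac{\lambda_0}{\lambda_0-s}\chi(s),\quad h_1(s)=\tfrac{\lambda_1}{\lambda_1-s}\psi(s).$$ Define $K_{i,j}(s)$ by $K_{0,0}=1$, $K_{-1,\cdot}=K_{\cdot,-1}=0$ and, for $(i,j)\neq(0,0)$, $$K_{i,j}(s)=K_{i-1,j}(s)\,h_0(a_0^{i-1}a_1^{j}s)+K_{i,j-1}(s)\,h_1(a_0^{i}a_1^{j-1}s).$$ Call $s$ with $\mathrm{Re}\,s\ge0$ regular if $a_0^ia_1^js\notin\{\lambda_0,\lambda_1\}$ for all $i,j\ge 0$. For constants $D_1,D_2\in\mathbb C$ let $L^{D}(s)=\frac{sD_1+s^2D_2}{(\lambda_0-s)(\lambda_1-s)}$.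 Write $x^-=\min(x,0)$ and $x^+=\max(x,0)$. **Transient case.** Let $(B_n,T_n,J_n^{(0)},J_n^{(1)})_{n\ge1}$ be i.i.d. copies of $(B,T,J^{(0)},J^{(1)})$, let $w\ge0$, $W_1=w$ and $$W_{n+1}=[a_0W_n+B_n-J^{(0)}_n]^+\ \text{ if } B_n<T_n,\qquad W_{n+1}=[a_1W_n+T_n-J^{(1)}_n]^+\ \text{ if } B_n\ge T_n.$$ Let $|r|<1$, $Z_w(s)=\sum_{n\ge1}r^nE(e^{-sW_n})$ for $\mathrm{Re}\,s\ge0$ and, for $\mathrm{Re}\,s\le0$, $M_w(s)=\sum_{n\ge1}r^n\big(E(e^{-s[a_0W_n+B_n-J_n^{(0)}]^-}1(B_n<T_n))+E(e^{-s[a_1W_n+T_n-J_n^{(1)}]^-}1(B_n\ge T_n))\big)$. These series converge, and $Z_w$ is continuous on $\mathrm{Re}\,s\ge0$ and analytic on $\mathrm{Re}\,s>0$. There are constants $C_1,C_2$ (depending on $r,w$) such that $$\prod_{k=0}^1(\lambda_k-s)\,(Z_w(s)-re^{-sw})-r\big(\lambda_0(\lambda_1-s)\chi(s)Z_w(a_0s)+\lambda_1(\lambda_0-s)\psi(s)Z_w(a_1s)\big)=sC_1+s^2C_2\quad(\mathrm{Re}\,s\ge0),$$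 $$\prod_{k=0}^1(\lambda_k-s)\Big(\tfrac{r^2}{1-r}-rM_w(s)\Big)=sC_1+s^2C_2\quad(\mathrm{Re}\,s\le0),$$ $$-r(\lambda_1-\lambda_0)\chi(\lambda_0)Z_w(a_0\lambda_0)=C_1+\lambda_0C_2,\qquad -r(\lambda_0-\lambda_1)\psi(\lambda_1)Z_w(a_1\lambda_1)=C_1+\lambda_1C_2,\tag{1}$$ and for every regular $s$, with $L_w^{D}(s)=L^{D}(s)+re^{-sw}$, $$Z_w(s)=\sum_{i=0}^\infty r^i\sum_{k=0}^iK_{k,i-k}(s)\,L_w^{C}(a_0^ka_1^{i-k}s),\tag{2}$$ the series over $i$ being absolutely convergent (with any $D$ in place of $C$). If $\lambda_0\ne\lambda_1$ and $a_0\lambda_0$, $a_1\lambda_1$ are regular, then substituting (2) for $Z_w(a_0\lambda_0)$ and $Z_w(a_1\lambda_1)$ in (1) gives a $2\times2$ linear system whose unique solution is $(C_1,C_2)$. **Stationary case.** Let $W_\infty$ be a random variable, independent of $(B,T,J^{(0)},J^{(1)})$, that has the same distribution as the random variable equal to $[a_0W_\infty+B-J^{(0)}]^+$ if $B<T$ and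 to $[a_1W_\infty+T-J^{(1)}]^+$ if $B\ge T$. Let $Z(s)=E(e^{-sW_\infty})$ for $\mathrm{Re}\,s\ge0$ and, for $\mathrm{Re}\,s\le 0$, $M(s)=E(e^{-s[a_0W_\infty+B-J^{(0)}]^-}1(B<T))+E(e^{-s[a_1W_\infty+T-J^{(1)}]^-}1(B\ge T))$. Then $Z$ is continuous on $\mathrm{Re}\,s\ge0$ and analytic on $\mathrm{Re}\,s>0$, and there are constants $C_1,C_2$ such that $$\prod_{k=0}^1(\lambda_k-s)\,Z(s)-\big(\lambda_0(\lambda_1-s)\chi(s)Z(a_0s)+\lambda_1(\lambda_0-s)\psi(s)Z(a_1s)\big)=sC_1+s^2C_2\quad(\mathrm{Re}\,s\ge0),$$ $$\prod_{k=0}^1(\lambda_k-s)\,(1-M(s))=sC_1+s^2C_2\quad(\mathrm{Re}\,s\le0),$$ $$-(\lambda_1-\lambda_0)\chi(\lambda_0)Z(a_0\lambda_0)=C_1+\lambda_0C_2,\qquad -(\lambda_0-\lambda_1)\psi(\lambda_1)Z(a_1\lambda_1)=C_1+\lambda_1C_2,\tag{3}$$ and for every regular $s$ the following limit exists, the series over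 $i$ converges absolutely (with any $D$ in place of $C$), and $$Z(s)=\lim_{n\to\infty}\sum_{k=0}^nK_{k,n-k}(s)+\sum_{i=0}^\infty\sum_{k=0}^iK_{k,i-k}(s)\,L^{C}(a_0^ka_1^{i-k}s).\tag{4}$$ If $\lambda_0\ne\lambda_1$ and $a_0\lambda_0$, $a_1\lambda_1$ are regular, then substituting (4) for $Z(a_0\lambda_0)$ and $Z(a_1\lambda_1)$ in (3) gives a $2\times2$ linear system whose unique solution is $(C_1,C_2)$. **The case $a_0=a_1=a$.** In the stationary case with $a_0=a_1=a$ and $H(s)=h_0(s)+h_1(s)$, for every regular $s$ the infinite product (the limit of its partial products, which equals the limit in (4)) and the series (absolutely, with any $D$ in place of $C$) converge and $$Z(s)=\prod_{n=0}^\infty H(a^ns)+\sum_{n=0}^\infty L^{C}(a^ns)\prod_{j=0}^{n-1}H(a^js).\tag{5}$$ If $\lambda_0\ne\lambda_1$ and $a\lambda_0$, $a\lambda_1$ are regular, then substituting (5) for $Z(a\lambda_0)$ and $Z(a\lambda_1)$ in (3) gives a $2\times2$ linear system whose unique solution is $(C_1,C_2)$. -/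

import Mathlib

open MeasureTheory ProbabilityTheory Filter Topology

noncomputable section

namespace ThresholdAR

/-- One step of the reflected autoregression with threshold: from the waiting time `w`, the
service request `b`, the threshold `t` and the candidate interarrival times `j₀`, `j₁`. -/
def step (a₀ a₁ w b t j₀ j₁ : ℝ) : ℝ :=
  if b < t then max (a₀ * w + b - j₀) 0 else max (a₁ * w + t - j₁) 0

/-- The waiting times started from `w`. Customers are numbered from `0` here, so that
`waiting … n` is the waiting time of the customer with number `n + 1` when counting from `1`. -/
def waiting {Ω : Type*} (a₀ a₁ w : ℝ) (B T J₀ J₁ : ℕ → Ω → ℝ) : ℕ → Ω → ℝ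
  | 0, _ => w
  | n + 1, ω =>
      step a₀ a₁ (waiting a₀ a₁ w B T J₀ J₁ n ω) (B n ω) (T n ω) (J₀ n ω) (J₁ n ω)

/-- The random input of one step: `B`, `T` are nonnegative, `J₀`, `J₁` are exponential with rates
`l₀`, `l₁`, and the pair `(B, T)`, `J₀` and `J₁` are independent. No relation between `B` and `T`
is required; in particular they may be independent. -/
structure IsInput {Ω : Type*} [MeasurableSpace Ω] (P : Measure Ω) (l₀ l₁ : ℝ)
    (B T J₀ J₁ : Ω → ℝ) : Prop where
  measurable_B : Measurable B
  measurable_T : Measurable T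
  measurable_J₀ : Measurable J₀
  measurable_J₁ : Measurable J₁
  nonneg_B : ∀ᵐ ω ∂P, 0 ≤ B ω
  nonneg_T : ∀ᵐ ω ∂P, 0 ≤ T ω
  law_J₀ : HasLaw J₀ (expMeasure l₀) P
  law_J₁ : HasLaw J₁ (expMeasure l₁) P
  indep_BT_J : IndepFun (fun ω => (B ω, T ω)) (fun ω => (J₀ ω, J₁ ω)) P
  indep_J : IndepFun J₀ J₁ P

/-- An i.i.d. sequence of inputs. -/
structure IsInputSequence {Ω : Type*} [MeasurableSpace Ω] (P : Measure Ω) (l₀ l₁ : ℝ)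
    (B T J₀ J₁ : ℕ → Ω → ℝ) : Prop where
  input : ∀ n, IsInput P l₀ l₁ (B n) (T n) (J₀ n) (J₁ n)
  indep : iIndepFun (fun n ω => (B n ω, T n ω, J₀ n ω, J₁ n ω)) P
  ident : ∀ n, IdentDistrib (fun ω => (B n ω, T n ω, J₀ n ω, J₁ n ω))
    (fun ω => (B 0 ω, T 0 ω, J₀ 0 ω, J₁ 0 ω)) P P

/-- `W` is a stationary waiting time for the recursion driven by `(B, T, J₀, J₁)`: it is
independent of the input, and one step of the recursion does not change its distribution. -/
structure IsStationary {Ω : Type*} [MeasurableSpace Ω] (P : Measure Ω) (a₀ a₁ : ℝ)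
    (W B T J₀ J₁ : Ω → ℝ) : Prop where
  measurable_W : Measurable W
  indep : IndepFun W (fun ω => (B ω, T ω, J₀ ω, J₁ ω)) P
  ident : IdentDistrib (fun ω => step a₀ a₁ (W ω) (B ω) (T ω) (J₀ ω) (J₁ ω)) W P P

/-- Laplace–Stieltjes transform `E[e^{-sX}]`. -/
def lst {Ω : Type*} [MeasurableSpace Ω] (P : Measure Ω) (X : Ω → ℝ) (s : ℂ) : ℂ :=
  ∫ ω, Complex.exp (-s * (X ω : ℂ)) ∂P

/-- `χ(s) = E[e^{-sB} 1(B < T)]`. -/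
def chi {Ω : Type*} [MeasurableSpace Ω] (P : Measure Ω) (B T : Ω → ℝ) (s : ℂ) : ℂ :=
  ∫ ω in {ω | B ω < T ω}, Complex.exp (-s * (B ω : ℂ)) ∂P

/-- `ψ(s) = E[e^{-sT} 1(B ≥ T)]`. -/
def psi {Ω : Type*} [MeasurableSpace Ω] (P : Measure Ω) (B T : Ω → ℝ) (s : ℂ) : ℂ :=
  ∫ ω in {ω | T ω ≤ B ω}, Complex.exp (-s * (T ω : ℂ)) ∂P

/-- `E[e^{-s[a₀W+B-J₀]⁻} 1(B < T)] + E[e^{-s[a₁W+T-J₁]⁻} 1(B ≥ T)]`, where `x⁻ = min(x, 0)`. -/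
def negTransform {Ω : Type*} [MeasurableSpace Ω] (P : Measure Ω) (a₀ a₁ : ℝ)
    (W B T J₀ J₁ : Ω → ℝ) (s : ℂ) : ℂ :=
  (∫ ω in {ω | B ω < T ω},
      Complex.exp (-s * ((min (a₀ * W ω + B ω - J₀ ω) 0 : ℝ) : ℂ)) ∂P) +
    ∫ ω in {ω | T ω ≤ B ω},
      Complex.exp (-s * ((min (a₁ * W ω + T ω - J₁ ω) 0 : ℝ) : ℂ)) ∂P

/-- The generating function `∑_{n ≥ 1} rⁿ fₙ` of a sequence whose `n`-th term is listed as
`f (n - 1)`. -/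
def genFun (r : ℂ) (f : ℕ → ℂ) : ℂ := ∑' n : ℕ, r ^ (n + 1) * f n

/-- `h(s) = l / (l - s) · φ(s)`; applied to `(l₀, χ)` and `(l₁, ψ)` it gives `h₀` and `h₁`. -/
def hFun (l : ℝ) (φ : ℂ → ℂ) (s : ℂ) : ℂ := (l : ℂ) / ((l : ℂ) - s) * φ s

/-- `L(s) = (s C₁ + s² C₂) / ((l₀ - s)(l₁ - s))`. -/
def LFun (l₀ l₁ : ℝ) (C₁ C₂ : ℂ) (s : ℂ) : ℂ :=
  (s * C₁ + s ^ 2 * C₂) / (((l₀ : ℂ) - s) * ((l₁ : ℂ) - s))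

/-- The lattice-path weights `K_{i,j}(s)`. -/
def pathK (a₀ a₁ : ℝ) (h₀ h₁ : ℂ → ℂ) (s : ℂ) : ℕ → ℕ → ℂ
  | 0, 0 => 1
  | i + 1, 0 => pathK a₀ a₁ h₀ h₁ s i 0 * h₀ ((a₀ : ℂ) ^ i * s)
  | 0, j + 1 => pathK a₀ a₁ h₀ h₁ s 0 j * h₁ ((a₁ : ℂ) ^ j * s)
  | i + 1, j + 1 =>
      pathK a₀ a₁ h₀ h₁ s i (j + 1) * h₀ ((a₀ : ℂ) ^ i * (a₁ : ℂ) ^ (j + 1) * s) +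
        pathK a₀ a₁ h₀ h₁ s (i + 1) j * h₁ ((a₀ : ℂ) ^ (i + 1) * (a₁ : ℂ) ^ j * s)

/-- `∑_{k=0}^{n} K_{k,n-k}(s) f(a₀^k a₁^{n-k} s)`. -/
def pathSum (a₀ a₁ : ℝ) (h₀ h₁ f : ℂ → ℂ) (n : ℕ) (s : ℂ) : ℂ :=
  ∑ k ∈ Finset.range (n + 1),
    pathK a₀ a₁ h₀ h₁ s k (n - k) * f ((a₀ : ℂ) ^ k * (a₁ : ℂ) ^ (n - k) * s)

/-- `s` lies in the closed right half-plane and none of the points `a₀^i a₁^j s` is one of the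
poles `l₀`, `l₁`, so that all terms of the lattice-path expansion at `s` are defined. -/
def Regular (a₀ a₁ l₀ l₁ : ℝ) (s : ℂ) : Prop :=
  0 ≤ s.re ∧ ∀ i j : ℕ,
    (a₀ : ℂ) ^ i * (a₁ : ℂ) ^ j * s ≠ (l₀ : ℂ) ∧ (a₀ : ℂ) ^ i * (a₁ : ℂ) ^ j * s ≠ (l₁ : ℂ)

end ThresholdAR

end

/-! For an exponential `J` of rate `l` and `x ≥ 0`, `(l - s) E[e^{-s[x-J]⁺}] = l e^{-sx} - s
e^{-lx}`. Hence one step of the recursion acts on transforms, up to the factor `(l₀ - s)(l₁ - s)`,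
by the linear operator `balance`. Besides `F(a₀ s)` and `F(a₁ s)`, it involves `F` only through the
numbers `χ(l₀) F(a₀ l₀)` and `ψ(l₁) F(a₁ l₁)`. These two numbers are the constants in disguise
(`const₁`, `const₂`), which makes (1) and (3) algebraic identities. The same computation for
`[x-J]⁻` gives the equations for `M`.

At regular points one may divide and iterate: `F` equals a partial sum of the lattice-path series
plus the remainder `rⁿ pathSum F n` (`eq_sum_pathSum_add`). Near `0` the weights satisfy `|h₀(x)| +
|h₁(x)| ≤ 1 + c|x|`, and the orbit shrinks geometrically, so the total path weight stays bounded
(`exists_pathMass_le`). If `|r| < 1`, the remainder vanishes. In the stationary case `r = 1`, `Z(0)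
= 1` and continuity allow `Z` to be replaced by `1` in the remainder, which produces the limit of
the weight sums.

Uniqueness of the constants (`homogeneous_system`) is the delicate point, since no determinant is
computed. The system defines an endomorphism `A` of `ℂ²`; surjectivity is proved instead of
injectivity. Running the recursion from `m` and from `0` with the same input and summing the
differences solves the functional equation with inhomogeneity `e^{-ms} - 1`; the constants of that
solution exhibit a vector in the range of `A`. Combinations of these exponentials concentrate at a
chosen point (`peak`), and their limits, still in the closed range, supply exactly the vectors by
which `A` differs from the Vandermonde map `D ↦ (D₁ + l₀D₂, D₁ + l₁D₂)`. That map is onto because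
`l₀ ≠ l₁`. -/

noncomputable section

namespace ThresholdAR

/-! ### Lattice-path sums: recursion, bounded total weight, convergence. -/

section LatticePaths

variable {a₀ a₁ l₀ l₁ : ℝ} {h₀ h₁ f g : ℂ → ℂ} {s : ℂ}

/-- If `K` splits off the origin as a sum of a part fed from the left and a part fed from below,
then its sums over an antidiagonal can be pulled back to the preceding antidiagonal. -/
lemma sum_antidiagonal_succ_add {M : Type*} [AddCommMonoid M] (n : ℕ) (A A' B B' : ℕ → ℕ → M)
    (hA₀ : ∀ j, A 0 j = 0) (hA : ∀ i j, A (i + 1) j = A' i j)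
    (hB₀ : ∀ i, B i 0 = 0) (hB : ∀ i j, B i (j + 1) = B' i j) :
    ∑ p ∈ Finset.HasAntidiagonal.antidiagonal (n + 1), (A p.1 p.2 + B p.1 p.2)
      = ∑ p ∈ Finset.HasAntidiagonal.antidiagonal n, (A' p.1 p.2 + B' p.1 p.2) := by
  rw [Finset.sum_add_distrib, Finset.sum_add_distrib, Finset.Nat.sum_antidiagonal_succ,
    Finset.Nat.sum_antidiagonal_succ' (f := fun p => B p.1 p.2)]
  simp [hA₀, hA, hB₀, hB]

/-- The part of `K_{i,j}` that comes from the paths whose last step is in the first direction. -/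
def pathLeft (a₀ a₁ : ℝ) (h₀ h₁ : ℂ → ℂ) (s : ℂ) : ℕ → ℕ → ℂ
  | 0, _ => 0
  | i + 1, j => pathK a₀ a₁ h₀ h₁ s i j * h₀ ((a₀ : ℂ) ^ i * (a₁ : ℂ) ^ j * s)

/-- The part of `K_{i,j}` that comes from the paths whose last step is in the second direction. -/
def pathDown (a₀ a₁ : ℝ) (h₀ h₁ : ℂ → ℂ) (s : ℂ) : ℕ → ℕ → ℂ
  | _, 0 => 0
  | i, j + 1 => pathK a₀ a₁ h₀ h₁ s i j * h₁ ((a₀ : ℂ) ^ i * (a₁ : ℂ) ^ j * s)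

lemma pathK_eq_add (i j : ℕ) (h : i + j ≠ 0) :
    pathK a₀ a₁ h₀ h₁ s i j = pathLeft a₀ a₁ h₀ h₁ s i j + pathDown a₀ a₁ h₀ h₁ s i j := by
  rcases i with _ | i <;> rcases j with _ | j <;> simp_all [pathK, pathLeft, pathDown]

lemma pathSum_eq_sum_antidiagonal (n : ℕ) :
    pathSum a₀ a₁ h₀ h₁ f n s = ∑ p ∈ Finset.HasAntidiagonal.antidiagonal n,
      pathK a₀ a₁ h₀ h₁ s p.1 p.2 * f ((a₀ : ℂ) ^ p.1 * (a₁ : ℂ) ^ p.2 * s) :=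
  (Finset.Nat.sum_antidiagonal_eq_sum_range_succ
    (fun i j => pathK a₀ a₁ h₀ h₁ s i j * f ((a₀ : ℂ) ^ i * (a₁ : ℂ) ^ j * s)) n).symm

@[simp]
lemma pathSum_zero : pathSum a₀ a₁ h₀ h₁ f 0 s = f s := by
  simp [pathSum, pathK]

/-- Peeling off the last step of each path shows that `pathSum · n` is the `n`-th iterate of `f ↦ h₀
f(a₀ ·) + h₁ f(a₁ ·)`. This is what lets the functional equation be iterated by induction. -/
lemma pathSum_succ (n : ℕ) :
    pathSum a₀ a₁ h₀ h₁ f (n + 1) s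
      = pathSum a₀ a₁ h₀ h₁ (fun x => h₀ x * f (a₀ * x) + h₁ x * f (a₁ * x)) n s := by
  rw [pathSum_eq_sum_antidiagonal, pathSum_eq_sum_antidiagonal]
  have h := sum_antidiagonal_succ_add n
    (fun i j => pathLeft a₀ a₁ h₀ h₁ s i j * f ((a₀ : ℂ) ^ i * (a₁ : ℂ) ^ j * s))
    (fun i j => pathK a₀ a₁ h₀ h₁ s i j * (h₀ ((a₀ : ℂ) ^ i * (a₁ : ℂ) ^ j * s)
      * f (a₀ * ((a₀ : ℂ) ^ i * (a₁ : ℂ) ^ j * s))))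
    (fun i j => pathDown a₀ a₁ h₀ h₁ s i j * f ((a₀ : ℂ) ^ i * (a₁ : ℂ) ^ j * s))
    (fun i j => pathK a₀ a₁ h₀ h₁ s i j * (h₁ ((a₀ : ℂ) ^ i * (a₁ : ℂ) ^ j * s)
      * f (a₁ * ((a₀ : ℂ) ^ i * (a₁ : ℂ) ^ j * s))))
    (fun j => by simp [pathLeft]) (fun i j => by
      simp only [pathLeft]
      rw [show (a₀ : ℂ) ^ (i + 1) * (a₁ : ℂ) ^ j * s = a₀ * ((a₀ : ℂ) ^ i * (a₁ : ℂ) ^ j * s) by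
        ring]
      ring)
    (fun i => by simp [pathDown]) (fun i j => by
      simp only [pathDown]
      rw [show (a₀ : ℂ) ^ i * (a₁ : ℂ) ^ (j + 1) * s = a₁ * ((a₀ : ℂ) ^ i * (a₁ : ℂ) ^ j * s) by
        ring]
      ring)
  simp only [mul_add]
  rw [← h]
  refine Finset.sum_congr rfl fun p hp => ?_
  rw [Finset.HasAntidiagonal.mem_antidiagonal] at hp
  rw [pathK_eq_add _ _ (by omega), add_mul]

lemma pathSum_congr (n : ℕ)
    (h : ∀ i j : ℕ, i + j = n →
      f ((a₀ : ℂ) ^ i * (a₁ : ℂ) ^ j * s) = g ((a₀ : ℂ) ^ i * (a₁ : ℂ) ^ j * s)) :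
    pathSum a₀ a₁ h₀ h₁ f n s = pathSum a₀ a₁ h₀ h₁ g n s := by
  rw [pathSum_eq_sum_antidiagonal, pathSum_eq_sum_antidiagonal]
  refine Finset.sum_congr rfl fun p hp => ?_
  rw [h _ _ (Finset.HasAntidiagonal.mem_antidiagonal.1 hp)]

lemma pathSum_add (n : ℕ) :
    pathSum a₀ a₁ h₀ h₁ (fun x => f x + g x) n s
      = pathSum a₀ a₁ h₀ h₁ f n s + pathSum a₀ a₁ h₀ h₁ g n s := by
  simp [pathSum, mul_add, Finset.sum_add_distrib]

lemma pathSum_const_mul (n : ℕ) (c : ℂ) :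
    pathSum a₀ a₁ h₀ h₁ (fun x => c * f x) n s = c * pathSum a₀ a₁ h₀ h₁ f n s := by
  simp only [pathSum, Finset.mul_sum]
  exact Finset.sum_congr rfl fun _ _ => by ring

lemma pathSum_finsetSum {ι : Type*} (t : Finset ι) (φ : ι → ℂ → ℂ) (n : ℕ) :
    pathSum a₀ a₁ h₀ h₁ (fun x => ∑ m ∈ t, φ m x) n s
      = ∑ m ∈ t, pathSum a₀ a₁ h₀ h₁ (φ m) n s := by
  simp only [pathSum, Finset.mul_sum]
  exact Finset.sum_comm

/-- With equal autoregression coefficients the lattice-path sums are products. -/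
lemma pathSum_eq_prod (a : ℝ) (f : ℂ → ℂ) (n : ℕ) :
    pathSum a a h₀ h₁ f n s = f ((a : ℂ) ^ n * s)
      * ∏ j ∈ Finset.range n, (h₀ ((a : ℂ) ^ j * s) + h₁ ((a : ℂ) ^ j * s)) := by
  induction n generalizing f with
  | zero => simp
  | succ n ih =>
    rw [pathSum_succ, ih, Finset.prod_range_succ, ← mul_assoc (a : ℂ), ← pow_succ']
    ring

/-- The total absolute weight of the paths of length `n`. -/
def pathMass (a₀ a₁ : ℝ) (h₀ h₁ : ℂ → ℂ) (n : ℕ) (s : ℂ) : ℝ :=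
  ∑ p ∈ Finset.HasAntidiagonal.antidiagonal n, ‖pathK a₀ a₁ h₀ h₁ s p.1 p.2‖

lemma pathMass_nonneg (n : ℕ) : 0 ≤ pathMass a₀ a₁ h₀ h₁ n s :=
  Finset.sum_nonneg fun _ _ => norm_nonneg _

lemma norm_pathSum_le (n : ℕ) {c : ℝ}
    (h : ∀ i j : ℕ, i + j = n → ‖f ((a₀ : ℂ) ^ i * (a₁ : ℂ) ^ j * s)‖ ≤ c) :
    ‖pathSum a₀ a₁ h₀ h₁ f n s‖ ≤ pathMass a₀ a₁ h₀ h₁ n s * c := by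
  rw [pathSum_eq_sum_antidiagonal, pathMass, Finset.sum_mul]
  refine (norm_sum_le _ _).trans (Finset.sum_le_sum fun p hp => ?_)
  rw [norm_mul]
  exact mul_le_mul_of_nonneg_left (h _ _ (Finset.HasAntidiagonal.mem_antidiagonal.1 hp))
    (norm_nonneg _)

lemma pathMass_succ_le (n : ℕ) {c : ℝ}
    (h : ∀ i j : ℕ, i + j = n → ‖h₀ ((a₀ : ℂ) ^ i * (a₁ : ℂ) ^ j * s)‖
      + ‖h₁ ((a₀ : ℂ) ^ i * (a₁ : ℂ) ^ j * s)‖ ≤ c) :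
    pathMass a₀ a₁ h₀ h₁ (n + 1) s ≤ pathMass a₀ a₁ h₀ h₁ n s * c := by
  have hs := sum_antidiagonal_succ_add n
    (fun i j => ‖pathLeft a₀ a₁ h₀ h₁ s i j‖)
    (fun i j => ‖pathK a₀ a₁ h₀ h₁ s i j‖ * ‖h₀ ((a₀ : ℂ) ^ i * (a₁ : ℂ) ^ j * s)‖)
    (fun i j => ‖pathDown a₀ a₁ h₀ h₁ s i j‖)
    (fun i j => ‖pathK a₀ a₁ h₀ h₁ s i j‖ * ‖h₁ ((a₀ : ℂ) ^ i * (a₁ : ℂ) ^ j * s)‖)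
    (fun j => by simp [pathLeft]) (fun i j => by simp [pathLeft])
    (fun i => by simp [pathDown]) (fun i j => by simp [pathDown])
  calc pathMass a₀ a₁ h₀ h₁ (n + 1) s
      ≤ ∑ p ∈ Finset.HasAntidiagonal.antidiagonal (n + 1),
        (‖pathLeft a₀ a₁ h₀ h₁ s p.1 p.2‖ + ‖pathDown a₀ a₁ h₀ h₁ s p.1 p.2‖) := by
        refine Finset.sum_le_sum fun p hp => ?_
        rw [Finset.HasAntidiagonal.mem_antidiagonal] at hp
        rw [pathK_eq_add _ _ (by omega)]
        exact norm_add_le _ _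
    _ ≤ pathMass a₀ a₁ h₀ h₁ n s * c := by
        rw [hs, pathMass, Finset.sum_mul]
        refine Finset.sum_le_sum fun p hp => ?_
        rw [← mul_add]
        exact mul_le_mul_of_nonneg_left (h _ _ (Finset.HasAntidiagonal.mem_antidiagonal.1 hp))
          (norm_nonneg _)

lemma orbit_mul_re (i j : ℕ) :
    ((a₀ : ℂ) ^ i * (a₁ : ℂ) ^ j * s).re = a₀ ^ i * a₁ ^ j * s.re := by
  rw [← Complex.ofReal_pow, ← Complex.ofReal_pow, ← Complex.ofReal_mul, Complex.re_ofReal_mul]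

lemma orbit_re_nonneg (ha₀ : a₀ ∈ Set.Ioo (0 : ℝ) 1) (ha₁ : a₁ ∈ Set.Ioo (0 : ℝ) 1)
    (hs : 0 ≤ s.re) (i j : ℕ) : 0 ≤ ((a₀ : ℂ) ^ i * (a₁ : ℂ) ^ j * s).re := by
  rw [orbit_mul_re]
  have := ha₀.1
  have := ha₁.1
  positivity

lemma norm_orbit_le (ha₀ : a₀ ∈ Set.Ioo (0 : ℝ) 1) (ha₁ : a₁ ∈ Set.Ioo (0 : ℝ) 1)
    {i j n : ℕ} (hn : i + j = n) :
    ‖(a₀ : ℂ) ^ i * (a₁ : ℂ) ^ j * s‖ ≤ max a₀ a₁ ^ n * ‖s‖ := by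
  rw [norm_mul, norm_mul, norm_pow, norm_pow, Complex.norm_real, Complex.norm_real,
    Real.norm_of_nonneg ha₀.1.le, Real.norm_of_nonneg ha₁.1.le, ← hn, pow_add]
  have := ha₀.1
  have := ha₁.1
  gcongr
  · exact le_max_left _ _
  · exact le_max_right _ _

lemma max_mem_Ioo (ha₀ : a₀ ∈ Set.Ioo (0 : ℝ) 1) (ha₁ : a₁ ∈ Set.Ioo (0 : ℝ) 1) :
    max a₀ a₁ ∈ Set.Ioo (0 : ℝ) 1 :=
  ⟨lt_max_of_lt_left ha₀.1, max_lt ha₀.2 ha₁.2⟩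

/-- A property that holds near `0` in the right half-plane holds eventually along the orbit. -/
lemma eventually_orbit (ha₀ : a₀ ∈ Set.Ioo (0 : ℝ) 1) (ha₁ : a₁ ∈ Set.Ioo (0 : ℝ) 1)
    (hs : 0 ≤ s.re) {p : ℂ → Prop} (hp : ∀ᶠ x in 𝓝[{x | 0 ≤ x.re}] (0 : ℂ), p x) :
    ∀ᶠ n : ℕ in atTop, ∀ i j : ℕ, i + j = n → p ((a₀ : ℂ) ^ i * (a₁ : ℂ) ^ j * s) := by
  rw [Metric.nhdsWithin_basis_ball.eventually_iff] at hp
  obtain ⟨ε, hε, h⟩ := hp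
  have hm := max_mem_Ioo ha₀ ha₁
  have ht : Tendsto (fun n : ℕ => max a₀ a₁ ^ n * ‖s‖) atTop (𝓝 0) := by
    simpa using (tendsto_pow_atTop_nhds_zero_of_lt_one hm.1.le hm.2).mul_const ‖s‖
  filter_upwards [ht.eventually_lt_const hε] with n hn i j hij
  refine h ⟨?_, orbit_re_nonneg ha₀ ha₁ hs i j⟩
  rw [mem_ball_zero_iff]
  exact (norm_orbit_le ha₀ ha₁ hij).trans_lt hn

lemma Regular.orbit (ha₀ : a₀ ∈ Set.Ioo (0 : ℝ) 1) (ha₁ : a₁ ∈ Set.Ioo (0 : ℝ) 1)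
    (hs : Regular a₀ a₁ l₀ l₁ s) (i j : ℕ) :
    Regular a₀ a₁ l₀ l₁ ((a₀ : ℂ) ^ i * (a₁ : ℂ) ^ j * s) := by
  refine ⟨orbit_re_nonneg ha₀ ha₁ hs.1 i j, fun i' j' => ?_⟩
  have h := hs.2 (i' + i) (j' + j)
  have e : (a₀ : ℂ) ^ i' * (a₁ : ℂ) ^ j' * ((a₀ : ℂ) ^ i * (a₁ : ℂ) ^ j * s)
      = (a₀ : ℂ) ^ (i' + i) * (a₁ : ℂ) ^ (j' + j) * s := by ring
  rw [e]
  exact h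

lemma Regular.ne (hs : Regular a₀ a₁ l₀ l₁ s) : s ≠ l₀ ∧ s ≠ l₁ := by
  simpa using hs.2 0 0

lemma norm_div_sub_le {l : ℝ} (hl : 0 < l) {x : ℂ} (hx : ‖x‖ ≤ l / 2) :
    ‖(l : ℂ) / ((l : ℂ) - x)‖ ≤ 1 + 2 / l * ‖x‖ := by
  have h1 : l - ‖x‖ ≤ ‖(l : ℂ) - x‖ := by
    have := norm_sub_norm_le (l : ℂ) x
    rwa [Complex.norm_real, Real.norm_of_nonneg hl.le] at this
  have h2 : 0 < l - ‖x‖ := by linarith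
  rw [norm_div, Complex.norm_real, Real.norm_of_nonneg hl.le, div_le_iff₀ (h2.trans_le h1)]
  -- With `t = ‖x‖ / l ≤ 1/2` this is `(1 + 2t)(1 - t) = 1 + t(1 - 2t) ≥ 1`.
  have h3 : l ≤ (1 + 2 / l * ‖x‖) * (l - ‖x‖) := by
    have : (1 + 2 / l * ‖x‖) * (l - ‖x‖) = l + ‖x‖ * (1 - 2 / l * ‖x‖) := by field_simp; ring
    rw [this]
    have h4 : 2 / l * ‖x‖ ≤ 1 := by rw [div_mul_eq_mul_div, div_le_one hl]; linarith
    nlinarith [norm_nonneg x]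
  exact h3.trans (by gcongr)

/-- The functions `χ`, `ψ` are dominated on the right half-plane by weights of total mass at
most `1`. -/
structure SubStochastic (χ ψ : ℂ → ℂ) : Prop where
  exists_bound : ∃ p₀ p₁ : ℝ, 0 ≤ p₀ ∧ 0 ≤ p₁ ∧ p₀ + p₁ ≤ 1 ∧
    ∀ s : ℂ, 0 ≤ s.re → ‖χ s‖ ≤ p₀ ∧ ‖ψ s‖ ≤ p₁

variable {χ ψ : ℂ → ℂ}

/-- The constant term is `1` because the masses of `χ` and `ψ` add up to at most `1`; an excess
linear in `‖x‖` is summable along the orbit. -/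
lemma SubStochastic.norm_hFun_add_le (hχψ : SubStochastic χ ψ) (hl₀ : 0 < l₀) (hl₁ : 0 < l₁)
    {x : ℂ} (hx : 0 ≤ x.re) (hx₀ : ‖x‖ ≤ l₀ / 2) (hx₁ : ‖x‖ ≤ l₁ / 2) :
    ‖hFun l₀ χ x‖ + ‖hFun l₁ ψ x‖ ≤ 1 + (2 / l₀ + 2 / l₁) * ‖x‖ := by
  obtain ⟨p₀, p₁, hp₀, hp₁, hp, h⟩ := hχψ.exists_bound
  have b₀ := norm_div_sub_le hl₀ hx₀
  have b₁ := norm_div_sub_le hl₁ hx₁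
  have c₀ : 0 ≤ 2 / l₀ * ‖x‖ := by positivity
  have c₁ : 0 ≤ 2 / l₁ * ‖x‖ := by positivity
  have k₀ : ‖hFun l₀ χ x‖ ≤ (1 + (2 / l₀ + 2 / l₁) * ‖x‖) * p₀ := by
    rw [hFun, norm_mul]
    exact mul_le_mul (by linarith) (h x hx).1 (norm_nonneg _) (by linarith)
  have k₁ : ‖hFun l₁ ψ x‖ ≤ (1 + (2 / l₀ + 2 / l₁) * ‖x‖) * p₁ := by
    rw [hFun, norm_mul]
    exact mul_le_mul (by linarith) (h x hx).2 (norm_nonneg _) (by linarith)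
  nlinarith

/-- The total absolute weight of the paths of length `n` is bounded in `n`. -/
lemma SubStochastic.exists_pathMass_le (hχψ : SubStochastic χ ψ)
    (ha₀ : a₀ ∈ Set.Ioo (0 : ℝ) 1) (ha₁ : a₁ ∈ Set.Ioo (0 : ℝ) 1) (hl₀ : 0 < l₀) (hl₁ : 0 < l₁)
    (hs : 0 ≤ s.re) :
    ∃ K : ℝ, 0 ≤ K ∧ ∀ n, pathMass a₀ a₁ (hFun l₀ χ) (hFun l₁ ψ) n s ≤ K := by
  have hm := max_mem_Ioo ha₀ ha₁
  set a := max a₀ a₁ with ha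
  set N : ℕ → ℝ := fun n => pathMass a₀ a₁ (hFun l₀ χ) (hFun l₁ ψ) n s with hN
  set c : ℝ := (2 / l₀ + 2 / l₁) * ‖s‖ with hc
  have hc0 : 0 ≤ c := by positivity
  have hev : ∀ᶠ x in 𝓝[{x | 0 ≤ x.re}] (0 : ℂ), ‖hFun l₀ χ x‖ + ‖hFun l₁ ψ x‖
      ≤ 1 + (2 / l₀ + 2 / l₁) * ‖x‖ := by
    have hb : ∀ ε > 0, ∀ᶠ x in 𝓝[{x | 0 ≤ x.re}] (0 : ℂ), ‖x‖ ≤ ε := fun ε hε => by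
      refine nhdsWithin_le_nhds ?_
      filter_upwards [Metric.closedBall_mem_nhds (0 : ℂ) hε] with x hx
      simpa using hx
    filter_upwards [self_mem_nhdsWithin, hb (l₀ / 2) (by positivity), hb (l₁ / 2) (by positivity)]
      with x hx h0 h1
    exact hχψ.norm_hFun_add_le hl₀ hl₁ hx h0 h1
  obtain ⟨n₀, hn₀⟩ := eventually_atTop.1 (eventually_orbit ha₀ ha₁ hs hev)
  -- Replacing `1 + c aⁿ` by its exponential turns the product of growth factors into a geometric
  -- sum in the exponent.
  have hstep : ∀ n ≥ n₀, N (n + 1) ≤ N n * Real.exp (c * a ^ n) := by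
    intro n hn
    refine pathMass_succ_le n fun i j hij => (hn₀ n hn i j hij).trans ?_
    have := norm_orbit_le (s := s) ha₀ ha₁ hij
    have h2 : (2 / l₀ + 2 / l₁) * ‖(a₀ : ℂ) ^ i * (a₁ : ℂ) ^ j * s‖ ≤ c * a ^ n := by
      calc _ ≤ (2 / l₀ + 2 / l₁) * (a ^ n * ‖s‖) := by gcongr
        _ = c * a ^ n := by rw [hc]; ring
    have := Real.add_one_le_exp (c * a ^ n)
    linarith
  have hbound : ∀ m, N (n₀ + m) ≤ N n₀ * Real.exp (c * ∑ i ∈ Finset.range m, a ^ i) := by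
    intro m
    induction m with
    | zero => simp
    | succ m ih =>
      refine (hstep (n₀ + m) (by omega)).trans ?_
      rw [Finset.sum_range_succ, mul_add, Real.exp_add, ← mul_assoc]
      have : a ^ (n₀ + m) ≤ a ^ m := pow_le_pow_of_le_one hm.1.le hm.2.le (by omega)
      have h0 : 0 ≤ N n₀ := pathMass_nonneg _
      gcongr
  have hbd : ∀ᶠ n in atTop, N n ≤ N n₀ * Real.exp (c * (1 - a)⁻¹) := by
    filter_upwards [eventually_ge_atTop n₀] with n hn
    obtain ⟨m, rfl⟩ := Nat.exists_eq_add_of_le hn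
    refine (hbound m).trans ?_
    have h0 : 0 ≤ N n₀ := pathMass_nonneg _
    have : ∑ i ∈ Finset.range m, a ^ i ≤ (1 - a)⁻¹ := by
      rw [← tsum_geometric_of_lt_one hm.1.le hm.2]
      exact (summable_geometric_of_lt_one hm.1.le hm.2).sum_le_tsum _
        fun i _ => pow_nonneg hm.1.le i
    gcongr
  -- The finitely many early terms, where orbit points may lie near the poles, only enlarge the
  -- constant.
  obtain ⟨K, hK⟩ := (isBoundedUnder_of_eventually_le hbd).bddAbove_range
  exact ⟨K, (pathMass_nonneg 0).trans (hK ⟨0, rfl⟩), fun n => hK ⟨n, rfl⟩⟩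

lemma SubStochastic.tendsto_pathSum_zero (hχψ : SubStochastic χ ψ)
    (ha₀ : a₀ ∈ Set.Ioo (0 : ℝ) 1) (ha₁ : a₁ ∈ Set.Ioo (0 : ℝ) 1) (hl₀ : 0 < l₀) (hl₁ : 0 < l₁)
    (hs : 0 ≤ s.re) (hf : Tendsto f (𝓝[{x | 0 ≤ x.re}] 0) (𝓝 0)) :
    Tendsto (fun n => pathSum a₀ a₁ (hFun l₀ χ) (hFun l₁ ψ) f n s) atTop (𝓝 0) := by
  obtain ⟨K, hK0, hK⟩ := hχψ.exists_pathMass_le ha₀ ha₁ hl₀ hl₁ hs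
  rw [Metric.tendsto_atTop']
  intro ε hε
  have hδ : 0 < ε / (K + 1) := by positivity
  have hev : ∀ᶠ x in 𝓝[{x | 0 ≤ x.re}] (0 : ℂ), ‖f x‖ ≤ ε / (K + 1) := by
    have := hf.norm.eventually_lt_const (u := ε / (K + 1)) (by simpa using hδ)
    exact this.mono fun x hx => hx.le
  obtain ⟨n₀, hn₀⟩ := eventually_atTop.1 (eventually_orbit ha₀ ha₁ hs hev)
  refine ⟨n₀, fun n hn => ?_⟩
  rw [dist_zero_right]
  refine (norm_pathSum_le n (hn₀ n hn.le)).trans_lt ?_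
  calc _ ≤ K * (ε / (K + 1)) := by gcongr; exact hK n
    _ < (K + 1) * (ε / (K + 1)) := by gcongr; linarith
    _ = ε := by field_simp

lemma SubStochastic.exists_norm_pathSum_le (hχψ : SubStochastic χ ψ)
    (ha₀ : a₀ ∈ Set.Ioo (0 : ℝ) 1) (ha₁ : a₁ ∈ Set.Ioo (0 : ℝ) 1) (hl₀ : 0 < l₀) (hl₁ : 0 < l₁)
    (hs : 0 ≤ s.re) (hf : f =O[𝓝[{x | 0 ≤ x.re}] 0] (fun _ => (1 : ℂ))) :
    ∃ c : ℝ, ∀ᶠ n : ℕ in atTop, ‖pathSum a₀ a₁ (hFun l₀ χ) (hFun l₁ ψ) f n s‖ ≤ c := by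
  obtain ⟨K, hK0, hK⟩ := hχψ.exists_pathMass_le ha₀ ha₁ hl₀ hl₁ hs
  obtain ⟨c, hc0, hc⟩ := hf.exists_pos
  refine ⟨K * c, ?_⟩
  filter_upwards [eventually_orbit ha₀ ha₁ hs hc.bound] with n hn
  refine (norm_pathSum_le n (c := c) fun i j hij => by simpa using hn i j hij).trans ?_
  gcongr
  exact hK n

/-- Here the decay comes from `|r| < 1`, so `f` need only be bounded near `0`. -/
lemma SubStochastic.summable_pathSum_of_isBigO_one (hχψ : SubStochastic χ ψ)
    (ha₀ : a₀ ∈ Set.Ioo (0 : ℝ) 1) (ha₁ : a₁ ∈ Set.Ioo (0 : ℝ) 1) (hl₀ : 0 < l₀) (hl₁ : 0 < l₁)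
    (hs : 0 ≤ s.re) (hf : f =O[𝓝[{x | 0 ≤ x.re}] 0] (fun _ => (1 : ℂ))) {r : ℂ} (hr : ‖r‖ < 1) :
    Summable (fun n => r ^ n * pathSum a₀ a₁ (hFun l₀ χ) (hFun l₁ ψ) f n s) := by
  obtain ⟨c, hc⟩ := hχψ.exists_norm_pathSum_le ha₀ ha₁ hl₀ hl₁ hs hf
  refine Summable.of_norm_bounded_eventually_nat
    ((summable_geometric_of_lt_one (norm_nonneg r) hr).mul_right c) ?_
  filter_upwards [hc] with n hn
  rw [norm_mul, norm_pow]
  gcongr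

lemma SubStochastic.tendsto_pow_mul_pathSum (hχψ : SubStochastic χ ψ)
    (ha₀ : a₀ ∈ Set.Ioo (0 : ℝ) 1) (ha₁ : a₁ ∈ Set.Ioo (0 : ℝ) 1) (hl₀ : 0 < l₀) (hl₁ : 0 < l₁)
    (hs : 0 ≤ s.re) (hf : f =O[𝓝[{x | 0 ≤ x.re}] 0] (fun _ => (1 : ℂ))) {r : ℂ} (hr : ‖r‖ < 1) :
    Tendsto (fun n => r ^ n * pathSum a₀ a₁ (hFun l₀ χ) (hFun l₁ ψ) f n s) atTop (𝓝 0) :=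
  (hχψ.summable_pathSum_of_isBigO_one ha₀ ha₁ hl₀ hl₁ hs hf hr).tendsto_atTop_zero

/-- Here the decay comes from `f` along the shrinking orbit, so `r = 1` is allowed; this serves the
stationary case and the uniqueness argument. -/
lemma SubStochastic.summable_pathSum_of_isBigO_id (hχψ : SubStochastic χ ψ)
    (ha₀ : a₀ ∈ Set.Ioo (0 : ℝ) 1) (ha₁ : a₁ ∈ Set.Ioo (0 : ℝ) 1) (hl₀ : 0 < l₀) (hl₁ : 0 < l₁)
    (hs : 0 ≤ s.re) (hf : f =O[𝓝[{x | 0 ≤ x.re}] 0] (fun x => x)) {r : ℂ} (hr : ‖r‖ ≤ 1) :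
    Summable (fun n => r ^ n * pathSum a₀ a₁ (hFun l₀ χ) (hFun l₁ ψ) f n s) := by
  have hm := max_mem_Ioo ha₀ ha₁
  obtain ⟨K, hK0, hK⟩ := hχψ.exists_pathMass_le ha₀ ha₁ hl₀ hl₁ hs
  obtain ⟨c, hc0, hc⟩ := hf.exists_pos
  refine Summable.of_norm_bounded_eventually_nat
    ((summable_geometric_of_lt_one hm.1.le hm.2).mul_left (K * (c * ‖s‖))) ?_
  filter_upwards [eventually_orbit ha₀ ha₁ hs hc.bound] with n hn
  rw [norm_mul, norm_pow]
  have h1 : ‖r‖ ^ n ≤ 1 := pow_le_one₀ (norm_nonneg r) hr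
  have h2 : ‖pathSum a₀ a₁ (hFun l₀ χ) (hFun l₁ ψ) f n s‖
      ≤ K * (c * (max a₀ a₁ ^ n * ‖s‖)) := by
    refine (norm_pathSum_le n (c := c * (max a₀ a₁ ^ n * ‖s‖)) fun i j hij => ?_).trans ?_
    · exact (hn i j hij).trans (by gcongr; exact norm_orbit_le ha₀ ha₁ hij)
    · have := hm.1
      gcongr
      exact hK n
  calc _ ≤ 1 * (K * (c * (max a₀ a₁ ^ n * ‖s‖))) := by gcongr
    _ = _ := by ring

lemma LFun_isBigO (hl₀ : 0 < l₀) (hl₁ : 0 < l₁) (D₁ D₂ : ℂ) (S : Set ℂ) :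
    LFun l₀ l₁ D₁ D₂ =O[𝓝[S] 0] (fun x => x) := by
  have h : DifferentiableAt ℂ (LFun l₀ l₁ D₁ D₂) 0 := by
    unfold LFun
    refine DifferentiableAt.div (by fun_prop) (by fun_prop) ?_
    simp [hl₀.ne', hl₁.ne']
  have h0 : LFun l₀ l₁ D₁ D₂ 0 = 0 := by simp [LFun]
  have := h.isBigO_sub
  simp only [h0, sub_zero] at this
  exact this.mono nhdsWithin_le_nhds

end LatticePaths

/-! ### The functional equation and its iteration. -/

section FunctionalEquation

variable {a₀ a₁ l₀ l₁ : ℝ} {h₀ h₁ f g F χ ψ : ℂ → ℂ} {r s : ℂ}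

/-- The image, up to the factor `(l₀ - s)(l₁ - s)`, of the transform `F` of a distribution under
one step of the recursion. -/
def balance (a₀ a₁ l₀ l₁ : ℝ) (χ ψ F : ℂ → ℂ) (s : ℂ) : ℂ :=
  (l₀ : ℂ) * ((l₁ : ℂ) - s) * χ s * F ((a₀ : ℂ) * s)
    + (l₁ : ℂ) * ((l₀ : ℂ) - s) * ψ s * F ((a₁ : ℂ) * s)
    - s * ((l₁ : ℂ) - s) * (χ l₀ * F ((a₀ : ℂ) * l₀))
    - s * ((l₀ : ℂ) - s) * (ψ l₁ * F ((a₁ : ℂ) * l₁))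

/-- `F` solves the functional equation with inhomogeneity `f` and killing factor `r`. -/
def IsSolution (a₀ a₁ l₀ l₁ : ℝ) (χ ψ : ℂ → ℂ) (r : ℂ) (f F : ℂ → ℂ) : Prop :=
  ∀ s : ℂ, 0 ≤ s.re →
    ((l₀ : ℂ) - s) * ((l₁ : ℂ) - s) * (F s - f s) = r * balance a₀ a₁ l₀ l₁ χ ψ F s

/-- The coefficient of `s` in the functional equation. -/
def const₁ (a₀ a₁ l₀ l₁ : ℝ) (χ ψ : ℂ → ℂ) (r : ℂ) (F : ℂ → ℂ) : ℂ :=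
  -r * ((l₁ : ℂ) * (χ l₀ * F ((a₀ : ℂ) * l₀)) + (l₀ : ℂ) * (ψ l₁ * F ((a₁ : ℂ) * l₁)))

/-- The coefficient of `s ^ 2` in the functional equation. -/
def const₂ (a₀ a₁ l₀ l₁ : ℝ) (χ ψ : ℂ → ℂ) (r : ℂ) (F : ℂ → ℂ) : ℂ :=
  r * (χ l₀ * F ((a₀ : ℂ) * l₀) + ψ l₁ * F ((a₁ : ℂ) * l₁))

lemma mul_balance_eq :
    r * balance a₀ a₁ l₀ l₁ χ ψ F s
      = r * ((l₀ : ℂ) * ((l₁ : ℂ) - s) * χ s * F ((a₀ : ℂ) * s)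
        + (l₁ : ℂ) * ((l₀ : ℂ) - s) * ψ s * F ((a₁ : ℂ) * s))
        + (s * const₁ a₀ a₁ l₀ l₁ χ ψ r F + s ^ 2 * const₂ a₀ a₁ l₀ l₁ χ ψ r F) := by
  simp only [balance, const₁, const₂]
  ring

/-- Holds for every `F`, straight from the explicit form of the constants; no evaluation of the
functional equation at its pole is needed. -/
lemma const_at_l₀ :
    -r * ((l₁ : ℂ) - (l₀ : ℂ)) * χ (l₀ : ℂ) * F ((a₀ : ℂ) * (l₀ : ℂ))
      = const₁ a₀ a₁ l₀ l₁ χ ψ r F + (l₀ : ℂ) * const₂ a₀ a₁ l₀ l₁ χ ψ r F := by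
  simp only [const₁, const₂]
  ring

lemma const_at_l₁ :
    -r * ((l₀ : ℂ) - (l₁ : ℂ)) * ψ (l₁ : ℂ) * F ((a₁ : ℂ) * (l₁ : ℂ))
      = const₁ a₀ a₁ l₀ l₁ χ ψ r F + (l₁ : ℂ) * const₂ a₀ a₁ l₀ l₁ χ ψ r F := by
  simp only [const₁, const₂]
  ring

lemma IsSolution.eq_add (h : IsSolution a₀ a₁ l₀ l₁ χ ψ r f F) (hs : 0 ≤ s.re)
    (hs₀ : s ≠ l₀) (hs₁ : s ≠ l₁) :
    F s = r * (hFun l₀ χ s * F ((a₀ : ℂ) * s) + hFun l₁ ψ s * F ((a₁ : ℂ) * s))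
      + (LFun l₀ l₁ (const₁ a₀ a₁ l₀ l₁ χ ψ r F) (const₂ a₀ a₁ l₀ l₁ χ ψ r F) s + f s) := by
  have e := h s hs
  rw [mul_balance_eq] at e
  have h0 : (l₀ : ℂ) - s ≠ 0 := sub_ne_zero.2 hs₀.symm
  have h1 : (l₁ : ℂ) - s ≠ 0 := sub_ne_zero.2 hs₁.symm
  simp only [hFun, LFun]
  generalize F ((a₀ : ℂ) * s) = x at e ⊢
  generalize F ((a₁ : ℂ) * s) = y at e ⊢
  field_simp
  linear_combination e

/-- Regularity passes to every point of the orbit, so the divided equation may be substituted into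
itself `n` times. -/
lemma eq_sum_pathSum_add (ha₀ : a₀ ∈ Set.Ioo (0 : ℝ) 1) (ha₁ : a₁ ∈ Set.Ioo (0 : ℝ) 1)
    (hF : ∀ x, Regular a₀ a₁ l₀ l₁ x →
      F x = r * (h₀ x * F ((a₀ : ℂ) * x) + h₁ x * F ((a₁ : ℂ) * x)) + g x)
    (hs : Regular a₀ a₁ l₀ l₁ s) (n : ℕ) :
    F s = ∑ i ∈ Finset.range n, r ^ i * pathSum a₀ a₁ h₀ h₁ g i s
      + r ^ n * pathSum a₀ a₁ h₀ h₁ F n s := by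
  induction n with
  | zero => simp
  | succ n ih =>
    rw [ih, Finset.sum_range_succ, pathSum_congr (g := fun x => r * (h₀ x * F ((a₀ : ℂ) * x) +
        h₁ x * F ((a₁ : ℂ) * x)) + g x) n fun i j _ => hF _ (hs.orbit ha₀ ha₁ i j),
      pathSum_add, pathSum_const_mul, pathSum_succ]
    ring

/-- The series `∑ rⁱ ∑_{k ≤ i} K_{k,i-k}(s) f(a₀^k a₁^{i-k} s)`. -/
def pathSeries (a₀ a₁ : ℝ) (h₀ h₁ : ℂ → ℂ) (r : ℂ) (f : ℂ → ℂ) (s : ℂ) : ℂ :=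
  ∑' i : ℕ, r ^ i * pathSum a₀ a₁ h₀ h₁ f i s

/-- Convergence of the series alone forces the remainder to converge. For `r = 1` the limit need not
be `0`, and this is how its existence is obtained. -/
lemma IsSolution.tendsto_pow_mul_pathSum (h : IsSolution a₀ a₁ l₀ l₁ χ ψ r f F)
    (ha₀ : a₀ ∈ Set.Ioo (0 : ℝ) 1) (ha₁ : a₁ ∈ Set.Ioo (0 : ℝ) 1)
    (hs : Regular a₀ a₁ l₀ l₁ s)
    (hsum : Summable (fun i => r ^ i * pathSum a₀ a₁ (hFun l₀ χ) (hFun l₁ ψ)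
      (fun x => LFun l₀ l₁ (const₁ a₀ a₁ l₀ l₁ χ ψ r F) (const₂ a₀ a₁ l₀ l₁ χ ψ r F) x + f x)
      i s)) :
    Tendsto (fun n => r ^ n * pathSum a₀ a₁ (hFun l₀ χ) (hFun l₁ ψ) F n s) atTop
      (𝓝 (F s - pathSeries a₀ a₁ (hFun l₀ χ) (hFun l₁ ψ) r
        (fun x => LFun l₀ l₁ (const₁ a₀ a₁ l₀ l₁ χ ψ r F) (const₂ a₀ a₁ l₀ l₁ χ ψ r F) x + f x)
        s)) := by
  refine (tendsto_const_nhds.sub hsum.hasSum.tendsto_sum_nat).congr fun n => ?_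
  nth_rewrite 1 [eq_sum_pathSum_add ha₀ ha₁ (fun x hx => h.eq_add hx.1 hx.ne.1 hx.ne.2) hs n]
  ring

lemma IsSolution.eq_pathSeries (h : IsSolution a₀ a₁ l₀ l₁ χ ψ r f F)
    (ha₀ : a₀ ∈ Set.Ioo (0 : ℝ) 1) (ha₁ : a₁ ∈ Set.Ioo (0 : ℝ) 1)
    (hs : Regular a₀ a₁ l₀ l₁ s)
    (hsum : Summable (fun i => r ^ i * pathSum a₀ a₁ (hFun l₀ χ) (hFun l₁ ψ)
      (fun x => LFun l₀ l₁ (const₁ a₀ a₁ l₀ l₁ χ ψ r F) (const₂ a₀ a₁ l₀ l₁ χ ψ r F) x + f x)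
      i s))
    (hlim : Tendsto (fun n => r ^ n * pathSum a₀ a₁ (hFun l₀ χ) (hFun l₁ ψ) F n s) atTop (𝓝 0)) :
    F s = pathSeries a₀ a₁ (hFun l₀ χ) (hFun l₁ ψ) r
      (fun x => LFun l₀ l₁ (const₁ a₀ a₁ l₀ l₁ χ ψ r F) (const₂ a₀ a₁ l₀ l₁ χ ψ r F) x + f x)
      s :=
  sub_eq_zero.1 (tendsto_nhds_unique (h.tendsto_pow_mul_pathSum ha₀ ha₁ hs hsum) hlim)

end FunctionalEquation

/-! ### Peak functions and uniqueness for the homogeneous linear system. -/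

section LinearSystem

variable {a₀ a₁ l₀ l₁ : ℝ} {h₀ h₁ f g F χ ψ : ℂ → ℂ} {r s : ℂ}

lemma pathSeries_add
    (hf : Summable (fun i => r ^ i * pathSum a₀ a₁ h₀ h₁ f i s))
    (hg : Summable (fun i => r ^ i * pathSum a₀ a₁ h₀ h₁ g i s)) :
    pathSeries a₀ a₁ h₀ h₁ r (fun x => f x + g x) s
      = pathSeries a₀ a₁ h₀ h₁ r f s + pathSeries a₀ a₁ h₀ h₁ r g s := by
  simp only [pathSeries, pathSum_add, mul_add]
  exact hf.tsum_add hg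

lemma pathSeries_const_mul (c : ℂ) :
    pathSeries a₀ a₁ h₀ h₁ r (fun x => c * f x) s = c * pathSeries a₀ a₁ h₀ h₁ r f s := by
  simp only [pathSeries, pathSum_const_mul, ← tsum_mul_left]
  exact tsum_congr fun i => by ring

lemma pathSeries_finsetSum {ι : Type*} (t : Finset ι) (φ : ι → ℂ → ℂ)
    (h : ∀ m ∈ t, Summable (fun i => r ^ i * pathSum a₀ a₁ h₀ h₁ (φ m) i s)) :
    pathSeries a₀ a₁ h₀ h₁ r (fun x => ∑ m ∈ t, φ m x) s
      = ∑ m ∈ t, pathSeries a₀ a₁ h₀ h₁ r (φ m) s := by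
  simp only [pathSeries, pathSum_finsetSum, Finset.mul_sum]
  exact Summable.tsum_finsetSum h

lemma LFun_add (D₁ D₂ E₁ E₂ : ℂ) :
    LFun l₀ l₁ (D₁ + E₁) (D₂ + E₂) = fun x => LFun l₀ l₁ D₁ D₂ x + LFun l₀ l₁ E₁ E₂ x := by
  funext x
  simp only [LFun, ← add_div]
  ring

lemma LFun_mul (c D₁ D₂ : ℂ) :
    LFun l₀ l₁ (c * D₁) (c * D₂) = fun x => c * LFun l₀ l₁ D₁ D₂ x := by
  funext x
  simp only [LFun]
  ring

/-- `((1 - e^{-x}) / (1 - e^{-P})) ^ N`: a combination of exponentials that concentrates at `P`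
as seen from `[0, P]`. -/
def peak (P : ℝ) (N : ℕ) (x : ℂ) : ℂ :=
  ((1 - Complex.exp (-x)) / ((1 - Real.exp (-P) : ℝ) : ℂ)) ^ N

lemma peak_ofReal (P : ℝ) (N : ℕ) (y : ℝ) :
    peak P N y = (((1 - Real.exp (-y)) / (1 - Real.exp (-P)) : ℝ) : ℂ) ^ N := by
  simp [peak]

lemma one_sub_exp_pos {P : ℝ} (hP : 0 < P) : 0 < 1 - Real.exp (-P) := by
  have : Real.exp (-P) < 1 := Real.exp_lt_one_iff.2 (by linarith)
  linarith

lemma tendsto_peak {P y : ℝ} (hP : 0 < P) (hy : 0 ≤ y) (hyP : y < P) :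
    Tendsto (fun N => peak P N y) atTop (𝓝 0) := by
  simp only [peak_ofReal]
  refine tendsto_pow_atTop_nhds_zero_of_norm_lt_one ?_
  have h := one_sub_exp_pos hP
  have h1 : Real.exp (-y) ≤ 1 := Real.exp_le_one_iff.2 (by linarith)
  have h2 : Real.exp (-P) < Real.exp (-y) := Real.exp_lt_exp.2 (by linarith)
  rw [Complex.norm_real, Real.norm_of_nonneg (div_nonneg (by linarith) h.le), div_lt_one h]
  linarith

/-- A bound uniform in `N` and linear in `y`, hence summable along the orbit. It needs `N ≥ 1`,
since the zeroth power does not vanish at `0`. -/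
lemma norm_peak_le {P y : ℝ} (hP : 0 < P) (hy : 0 ≤ y) (hyP : y ≤ P) {N : ℕ} (hN : 1 ≤ N) :
    ‖peak P N y‖ ≤ y / (1 - Real.exp (-P)) := by
  have h := one_sub_exp_pos hP
  have h1 : Real.exp (-y) ≤ 1 := Real.exp_le_one_iff.2 (by linarith)
  have h2 : Real.exp (-P) ≤ Real.exp (-y) := Real.exp_le_exp.2 (by linarith)
  have h3 : 0 ≤ (1 - Real.exp (-y)) / (1 - Real.exp (-P)) := div_nonneg (by linarith) h.le
  rw [peak_ofReal, norm_pow, Complex.norm_real, Real.norm_of_nonneg h3]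
  calc _ ≤ (1 - Real.exp (-y)) / (1 - Real.exp (-P)) :=
        pow_le_of_le_one h3 ((div_le_one h).2 (by linarith)) (by omega)
    _ ≤ _ := by
        gcongr
        have := Real.add_one_le_exp (-y)
        linarith

/-- All orbit points after the first lie strictly below `p ≤ P`, where the peak tends to `0`. Only
the term `i = 0` can survive, and it does so exactly when `p = P`. -/
lemma SubStochastic.tendsto_pathSeries_peak (hχψ : SubStochastic χ ψ)
    (ha₀ : a₀ ∈ Set.Ioo (0 : ℝ) 1) (ha₁ : a₁ ∈ Set.Ioo (0 : ℝ) 1) (hl₀ : 0 < l₀) (hl₁ : 0 < l₁)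
    (hr : ‖r‖ ≤ 1) {p P : ℝ} (hp : 0 < p) (hpP : p ≤ P) :
    Tendsto (fun N => pathSeries a₀ a₁ (hFun l₀ χ) (hFun l₁ ψ) r (peak P N) p) atTop
      (𝓝 (if p = P then 1 else 0)) := by
  have hm := max_mem_Ioo ha₀ ha₁
  have hP : 0 < P := hp.trans_le hpP
  obtain ⟨K, hK0, hK⟩ := hχψ.exists_pathMass_le (s := (p : ℂ)) ha₀ ha₁ hl₀ hl₁
    (by simpa using hp.le)
  have hE := one_sub_exp_pos hP
  have hcast : ∀ i j : ℕ, (a₀ : ℂ) ^ i * (a₁ : ℂ) ^ j * (p : ℂ) = ((a₀ ^ i * a₁ ^ j * p : ℝ) : ℂ) :=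
    fun i j => by push_cast; ring
  have hnn : ∀ i j : ℕ, 0 ≤ a₀ ^ i * a₁ ^ j * p := fun i j => by
    have := ha₀.1; have := ha₁.1; positivity
  have hle : ∀ i j n : ℕ, i + j = n → a₀ ^ i * a₁ ^ j * p ≤ max a₀ a₁ ^ n * p := by
    intro i j n hn
    have := norm_orbit_le (s := (p : ℂ)) ha₀ ha₁ hn
    rw [hcast, Complex.norm_real, Complex.norm_real, Real.norm_of_nonneg (hnn i j),
      Real.norm_of_nonneg hp.le] at this
    exact this
  have hpow : ∀ n : ℕ, max a₀ a₁ ^ n * p ≤ p := fun n =>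
    mul_le_of_le_one_left hp.le (pow_le_one₀ hm.1.le hm.2.le)
  have hlim : ∑' i : ℕ, (if i = 0 then (if p = P then (1 : ℂ) else 0) else 0)
      = if p = P then 1 else 0 := by simp
  rw [← hlim]
  unfold pathSeries
  refine tendsto_tsum_of_dominated_convergence
    (bound := fun i => K * (p / (1 - Real.exp (-P))) * max a₀ a₁ ^ i)
    ((summable_geometric_of_lt_one hm.1.le hm.2).mul_left _) ?_ ?_
  · intro n
    rcases Nat.eq_zero_or_pos n with rfl | hn
    · simp only [pow_zero, one_mul, pathSum_zero, if_true]
      rcases eq_or_ne p P with h | h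
      · subst h
        simp only [if_true, peak_ofReal, div_self hE.ne']
        simp
      · rw [if_neg h]
        exact tendsto_peak hP hp.le (lt_of_le_of_ne hpP h)
    · rw [if_neg hn.ne', ← mul_zero (r ^ n)]
      refine Tendsto.const_mul _ ?_
      simp only [pathSum_eq_sum_antidiagonal]
      rw [← Finset.sum_const_zero (s := Finset.HasAntidiagonal.antidiagonal n)]
      refine tendsto_finsetSum _ fun q hq => ?_
      rw [← mul_zero (pathK a₀ a₁ (hFun l₀ χ) (hFun l₁ ψ) p q.1 q.2)]
      refine Tendsto.const_mul _ ?_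
      rw [hcast]
      refine tendsto_peak hP (hnn _ _) (((hle _ _ n
        (Finset.HasAntidiagonal.mem_antidiagonal.1 hq)).trans_lt ?_).trans_le hpP)
      exact mul_lt_of_lt_one_left hp (pow_lt_one₀ hm.1.le hm.2 hn.ne')
  · filter_upwards [eventually_ge_atTop 1] with N hN n
    rw [norm_mul, norm_pow]
    have h1 : ‖r‖ ^ n ≤ 1 := pow_le_one₀ (norm_nonneg r) hr
    have h2 : ‖pathSum a₀ a₁ (hFun l₀ χ) (hFun l₁ ψ) (peak P N) n p‖
        ≤ K * (max a₀ a₁ ^ n * p / (1 - Real.exp (-P))) := by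
      refine (norm_pathSum_le n (c := max a₀ a₁ ^ n * p / (1 - Real.exp (-P)))
        fun i j hij => ?_).trans ?_
      · rw [hcast]
        refine (norm_peak_le hP (hnn i j) (((hle i j n hij).trans (hpow n)).trans hpP) hN).trans ?_
        exact div_le_div_of_nonneg_right (hle i j n hij) hE.le
      · have := hm.1
        gcongr
        exact hK n
    calc _ ≤ 1 * (K * (max a₀ a₁ ^ n * p / (1 - Real.exp (-P)))) := by gcongr
      _ = _ := by ring

lemma exp_sub_one_isBigO (m : ℕ) (S : Set ℂ) :
    (fun x : ℂ => Complex.exp (-x * m) - 1) =O[𝓝[S] 0] (fun x => x) := by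
  have h : DifferentiableAt ℂ (fun x : ℂ => Complex.exp (-x * m)) 0 := by fun_prop
  have := h.isBigO_sub
  simp only [neg_zero, zero_mul, Complex.exp_zero, sub_zero] at this
  exact this.mono nhdsWithin_le_nhds

/-- Binomial expansion. The alternating binomial coefficients sum to `0` for `N ≥ 1`, so `1` may be
subtracted from each exponential; every summand then vanishes at `0` and has a summable path series
even for `|r| = 1`. -/
lemma peak_eq_sum (P : ℝ) {N : ℕ} (hN : 1 ≤ N) (x : ℂ) :
    peak P N x = ∑ m ∈ Finset.range (N + 1),
      (((1 - Real.exp (-P) : ℝ) : ℂ)⁻¹ ^ N * ((-1) ^ m * (N.choose m : ℂ)))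
        * (Complex.exp (-x * m) - 1) := by
  have h1 : (1 - Complex.exp (-x)) ^ N
      = ∑ m ∈ Finset.range (N + 1), (-1) ^ m * (N.choose m : ℂ) * Complex.exp (-x * m) := by
    rw [sub_eq_neg_add, add_pow]
    refine Finset.sum_congr rfl fun m _ => ?_
    rw [neg_pow, ← Complex.exp_nat_mul, one_pow, mul_one, mul_comm (m : ℂ)]
    ring
  have h2 : (0 : ℂ) = ∑ m ∈ Finset.range (N + 1), (-1) ^ m * (N.choose m : ℂ) := by
    have := add_pow (-1 : ℂ) 1 N
    simp only [neg_add_cancel, one_pow, mul_one] at this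
    rw [← this, zero_pow (by omega)]
  rw [peak, div_eq_inv_mul, mul_pow]
  simp only [mul_assoc, ← Finset.mul_sum]
  congr 1
  simp only [← mul_assoc, mul_sub, mul_one, Finset.sum_sub_distrib]
  rw [← h2, sub_zero, h1]

/-- Uniqueness for the linear system: if the functional equation is solvable for the
inhomogeneities `e^{-ms} - 1`, then the homogeneous system has only the trivial solution. -/
lemma SubStochastic.homogeneous_system (hχψ : SubStochastic χ ψ)
    (ha₀ : a₀ ∈ Set.Ioo (0 : ℝ) 1) (ha₁ : a₁ ∈ Set.Ioo (0 : ℝ) 1) (hl₀ : 0 < l₀) (hl₁ : 0 < l₁)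
    (hr : ‖r‖ ≤ 1) (hl : l₀ ≠ l₁)
    (hreg₀ : Regular a₀ a₁ l₀ l₁ ((a₀ : ℂ) * (l₀ : ℂ)))
    (hreg₁ : Regular a₀ a₁ l₀ l₁ ((a₁ : ℂ) * (l₁ : ℂ)))
    (hsol : ∀ m : ℕ, ∃ F : ℂ → ℂ,
      IsSolution a₀ a₁ l₀ l₁ χ ψ r (fun x => Complex.exp (-x * m) - 1) F ∧
      F =O[𝓝[{x | 0 ≤ x.re}] 0] (fun x => x))
    {E₁ E₂ : ℂ}
    (hE₀ : -r * ((l₁ : ℂ) - (l₀ : ℂ)) * χ (l₀ : ℂ) * pathSeries a₀ a₁ (hFun l₀ χ) (hFun l₁ ψ) r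
      (LFun l₀ l₁ E₁ E₂) ((a₀ : ℂ) * (l₀ : ℂ)) = E₁ + (l₀ : ℂ) * E₂)
    (hE₁ : -r * ((l₀ : ℂ) - (l₁ : ℂ)) * ψ (l₁ : ℂ) * pathSeries a₀ a₁ (hFun l₀ χ) (hFun l₁ ψ) r
      (LFun l₀ l₁ E₁ E₂) ((a₁ : ℂ) * (l₁ : ℂ)) = E₁ + (l₁ : ℂ) * E₂) :
    E₁ = 0 ∧ E₂ = 0 := by
  set u₀ : ℂ := -r * ((l₁ : ℂ) - (l₀ : ℂ)) * χ (l₀ : ℂ) with hu₀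
  set u₁ : ℂ := -r * ((l₀ : ℂ) - (l₁ : ℂ)) * ψ (l₁ : ℂ) with hu₁
  set Φ : (ℂ → ℂ) → ℂ → ℂ := fun f s => pathSeries a₀ a₁ (hFun l₀ χ) (hFun l₁ ψ) r f s with hΦ
  have hsum : ∀ {f : ℂ → ℂ} {s : ℂ}, Regular a₀ a₁ l₀ l₁ s →
      f =O[𝓝[{x | 0 ≤ x.re}] 0] (fun x => x) →
      Summable (fun i => r ^ i * pathSum a₀ a₁ (hFun l₀ χ) (hFun l₁ ψ) f i s) :=
    fun hs hf => hχψ.summable_pathSum_of_isBigO_id ha₀ ha₁ hl₀ hl₁ hs.1 hf hr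
  have hL : ∀ D₁ D₂ : ℂ, LFun l₀ l₁ D₁ D₂ =O[𝓝[{x | 0 ≤ x.re}] 0] (fun x => x) :=
    fun D₁ D₂ => LFun_isBigO hl₀ hl₁ D₁ D₂ _
  have hΦadd : ∀ s, Regular a₀ a₁ l₀ l₁ s → ∀ D E : ℂ × ℂ,
      Φ (LFun l₀ l₁ (D.1 + E.1) (D.2 + E.2)) s
        = Φ (LFun l₀ l₁ D.1 D.2) s + Φ (LFun l₀ l₁ E.1 E.2) s := by
    intro s hs D E
    simp only [hΦ]
    rw [LFun_add, pathSeries_add (hsum hs (hL _ _)) (hsum hs (hL _ _))]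
  have hΦmul : ∀ s, ∀ (c : ℂ) (D : ℂ × ℂ),
      Φ (LFun l₀ l₁ (c * D.1) (c * D.2)) s = c * Φ (LFun l₀ l₁ D.1 D.2) s := by
    intro s c D
    simp only [hΦ]
    rw [LFun_mul, pathSeries_const_mul]
  -- The hypotheses `hE₀`, `hE₁` say that `(E₁, E₂)` lies in the kernel of `A`.
  let A : ℂ × ℂ →ₗ[ℂ] ℂ × ℂ :=
    { toFun := fun D => (D.1 + (l₀ : ℂ) * D.2 - u₀ * Φ (LFun l₀ l₁ D.1 D.2) ((a₀ : ℂ) * (l₀ : ℂ)),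
        D.1 + (l₁ : ℂ) * D.2 - u₁ * Φ (LFun l₀ l₁ D.1 D.2) ((a₁ : ℂ) * (l₁ : ℂ)))
      map_add' := fun D E => by
        simp only [Prod.fst_add, Prod.snd_add, hΦadd _ hreg₀, hΦadd _ hreg₁, Prod.mk_add_mk]
        congr 1 <;> ring
      map_smul' := fun c D => by
        simp only [Prod.smul_fst, Prod.smul_snd, smul_eq_mul, hΦmul, RingHom.id_apply,
          Prod.smul_mk]
        congr 1 <;> ring }
  set R : Submodule ℂ (ℂ × ℂ) := LinearMap.range A with hR
  have hRc : IsClosed (R : Set (ℂ × ℂ)) := R.closed_of_finiteDimensional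
  -- The preimage is the pair of constants of the solution `F`: substituting the series for `F` into
  -- the identities `const_at_l₀`, `const_at_l₁` leaves the contribution of the inhomogeneity as the
  -- value of `A`.
  have hexp : ∀ m : ℕ, (u₀ * Φ (fun x => Complex.exp (-x * m) - 1) ((a₀ : ℂ) * (l₀ : ℂ)),
      u₁ * Φ (fun x => Complex.exp (-x * m) - 1) ((a₁ : ℂ) * (l₁ : ℂ))) ∈ R := by
    intro m
    obtain ⟨F, hF, hFO⟩ := hsol m
    have hFeq : ∀ s, Regular a₀ a₁ l₀ l₁ s →
        F s = Φ (LFun l₀ l₁ (const₁ a₀ a₁ l₀ l₁ χ ψ r F) (const₂ a₀ a₁ l₀ l₁ χ ψ r F)) s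
          + Φ (fun x => Complex.exp (-x * m) - 1) s := by
      intro s hs
      have s1 := hsum hs (hL (const₁ a₀ a₁ l₀ l₁ χ ψ r F) (const₂ a₀ a₁ l₀ l₁ χ ψ r F))
      have s2 := hsum hs (exp_sub_one_isBigO m _)
      simp only [hΦ]
      rw [← pathSeries_add s1 s2]
      refine hF.eq_pathSeries ha₀ ha₁ hs (hsum hs ((hL _ _).add (exp_sub_one_isBigO m _))) ?_
      exact (hsum hs hFO).tendsto_atTop_zero
    refine ⟨(const₁ a₀ a₁ l₀ l₁ χ ψ r F, const₂ a₀ a₁ l₀ l₁ χ ψ r F), ?_⟩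
    have e0 := const_at_l₀ (a₀ := a₀) (a₁ := a₁) (l₀ := l₀) (l₁ := l₁) (χ := χ) (ψ := ψ)
      (r := r) (F := F)
    have e1 := const_at_l₁ (a₀ := a₀) (a₁ := a₁) (l₀ := l₀) (l₁ := l₁) (χ := χ) (ψ := ψ)
      (r := r) (F := F)
    rw [hFeq _ hreg₀] at e0
    rw [hFeq _ hreg₁] at e1
    refine Prod.ext ?_ ?_
    · show _ - _ = _
      rw [← e0, ← hu₀]
      ring
    · show _ - _ = _
      rw [← e1, ← hu₁]
      ring
  have hpeak : ∀ (P : ℝ) (N : ℕ), 1 ≤ N → (u₀ * Φ (peak P N) ((a₀ : ℂ) * (l₀ : ℂ)),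
      u₁ * Φ (peak P N) ((a₁ : ℂ) * (l₁ : ℂ))) ∈ R := by
    intro P N hN
    have e : ∀ s, Regular a₀ a₁ l₀ l₁ s → Φ (peak P N) s = ∑ m ∈ Finset.range (N + 1),
        (((1 - Real.exp (-P) : ℝ) : ℂ)⁻¹ ^ N * ((-1) ^ m * (N.choose m : ℂ)))
          * Φ (fun x => Complex.exp (-x * m) - 1) s := by
      intro s hs
      simp only [hΦ]
      rw [funext (peak_eq_sum P hN), pathSeries_finsetSum]
      · simp only [pathSeries_const_mul]
      · intro m _
        exact hsum hs ((exp_sub_one_isBigO m _).const_mul_left _)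
    rw [e _ hreg₀, e _ hreg₁]
    convert R.sum_mem (t := Finset.range (N + 1)) fun m _ => R.smul_mem
      (((1 - Real.exp (-P) : ℝ) : ℂ)⁻¹ ^ N * ((-1) ^ m * (N.choose m : ℂ))) (hexp m) using 1
    refine Prod.ext ?_ ?_
    · simp only [Prod.fst_sum, Prod.smul_fst, smul_eq_mul, Finset.mul_sum]
      exact Finset.sum_congr rfl fun _ _ => by ring
    · simp only [Prod.snd_sum, Prod.smul_snd, smul_eq_mul, Finset.mul_sum]
      exact Finset.sum_congr rfl fun _ _ => by ring
  have hp₀ : 0 < a₀ * l₀ := mul_pos ha₀.1 hl₀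
  have hp₁ : 0 < a₁ * l₁ := mul_pos ha₁.1 hl₁
  have hlim : ∀ {p P : ℝ}, 0 < p → p ≤ P →
      Tendsto (fun N => Φ (peak P N) p) atTop (𝓝 (if p = P then 1 else 0)) :=
    fun hp hpP => hχψ.tendsto_pathSeries_peak ha₀ ha₁ hl₀ hl₁ hr hp hpP
  have hc₀ : (a₀ : ℂ) * (l₀ : ℂ) = ((a₀ * l₀ : ℝ) : ℂ) := by push_cast; ring
  have hc₁ : (a₁ : ℂ) * (l₁ : ℂ) = ((a₁ * l₁ : ℝ) : ℂ) := by push_cast; ring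
  -- If `a₀l₀ ≠ a₁l₁`, limits of peaks put `(u₀, 0)` and `(0, u₁)` in the range. If `a₀l₀ = a₁l₁`
  -- they only give `(u₀, u₁)`, which suffices because `Φ` then takes the same value in both
  -- coordinates.
  have hsurjΦ : ∀ D : ℂ × ℂ, (u₀ * Φ (LFun l₀ l₁ D.1 D.2) ((a₀ : ℂ) * (l₀ : ℂ)),
      u₁ * Φ (LFun l₀ l₁ D.1 D.2) ((a₁ : ℂ) * (l₁ : ℂ))) ∈ R := by
    intro D
    have hN1 : ∀ᶠ N : ℕ in atTop, 1 ≤ N := eventually_ge_atTop 1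
    rcases lt_trichotomy (a₀ * l₀) (a₁ * l₁) with hlt | heq | hgt
    · have m1 : ((0 : ℂ), u₁) ∈ R := by
        have t := ((hlim hp₀ hlt.le).const_mul u₀).prodMk_nhds
          ((hlim hp₁ le_rfl).const_mul u₁)
        simp only [if_neg hlt.ne, if_true, mul_zero, mul_one] at t
        refine hRc.mem_of_tendsto t ?_
        filter_upwards [hN1] with N hN
        have := hpeak (a₁ * l₁) N hN
        rwa [hc₀, hc₁] at this
      have m0 : (u₀, (0 : ℂ)) ∈ R := by
        have t := ((hlim hp₀ le_rfl).const_mul u₀).prodMk_nhds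
          (tendsto_const_nhds (x := (0 : ℂ)))
        simp only [if_true, mul_one] at t
        refine hRc.mem_of_tendsto t ?_
        filter_upwards [hN1] with N hN
        have h1 := hpeak (a₀ * l₀) N hN
        rw [hc₀, hc₁] at h1
        -- A peak at the smaller point is not controlled at the larger one, so the second coordinate
        -- is cancelled exactly, with a multiple of `(0, u₁)`, before passing to the limit.
        have h2 := R.sub_mem h1 (R.smul_mem (Φ (peak (a₀ * l₀) N) ((a₁ * l₁ : ℝ) : ℂ)) m1)
        rw [SetLike.mem_coe]
        convert h2 using 1
        refine Prod.ext ?_ ?_ <;> simp [mul_comm]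
      convert R.add_mem (R.smul_mem (Φ (LFun l₀ l₁ D.1 D.2) ((a₀ : ℂ) * (l₀ : ℂ))) m0)
        (R.smul_mem (Φ (LFun l₀ l₁ D.1 D.2) ((a₁ : ℂ) * (l₁ : ℂ))) m1) using 1
      refine Prod.ext ?_ ?_ <;> simp [mul_comm]
    · have m : (u₀, u₁) ∈ R := by
        have t := ((hlim hp₀ heq.le).const_mul u₀).prodMk_nhds
          ((hlim hp₁ le_rfl).const_mul u₁)
        simp only [if_pos heq, if_true, mul_one] at t
        refine hRc.mem_of_tendsto t ?_
        filter_upwards [hN1] with N hN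
        have := hpeak (a₁ * l₁) N hN
        rwa [hc₀, hc₁] at this
      convert R.smul_mem (Φ (LFun l₀ l₁ D.1 D.2) ((a₀ : ℂ) * (l₀ : ℂ))) m using 1
      rw [hc₁, ← heq, ← hc₀]
      refine Prod.ext ?_ ?_ <;> simp [mul_comm]
    · have m0 : (u₀, (0 : ℂ)) ∈ R := by
        have t := ((hlim hp₀ le_rfl).const_mul u₀).prodMk_nhds
          ((hlim hp₁ hgt.le).const_mul u₁)
        simp only [if_neg hgt.ne, if_true, mul_zero, mul_one] at t
        refine hRc.mem_of_tendsto t ?_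
        filter_upwards [hN1] with N hN
        have := hpeak (a₀ * l₀) N hN
        rwa [hc₀, hc₁] at this
      have m1 : ((0 : ℂ), u₁) ∈ R := by
        have t := (tendsto_const_nhds (x := (0 : ℂ))).prodMk_nhds
          ((hlim hp₁ le_rfl).const_mul u₁)
        simp only [if_true, mul_one] at t
        refine hRc.mem_of_tendsto t ?_
        filter_upwards [hN1] with N hN
        have h1 := hpeak (a₁ * l₁) N hN
        rw [hc₀, hc₁] at h1
        have h2 := R.sub_mem h1 (R.smul_mem (Φ (peak (a₁ * l₁) N) ((a₀ * l₀ : ℝ) : ℂ)) m0)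
        rw [SetLike.mem_coe]
        convert h2 using 1
        refine Prod.ext ?_ ?_ <;> simp [mul_comm]
      convert R.add_mem (R.smul_mem (Φ (LFun l₀ l₁ D.1 D.2) ((a₀ : ℂ) * (l₀ : ℂ))) m0)
        (R.smul_mem (Φ (LFun l₀ l₁ D.1 D.2) ((a₁ : ℂ) * (l₁ : ℂ))) m1) using 1
      refine Prod.ext ?_ ?_ <;> simp [mul_comm]
  have hl' : (l₁ : ℂ) - l₀ ≠ 0 := sub_ne_zero.2 fun h => hl (Complex.ofReal_injective h).symm
  have hsurj : Function.Surjective A := by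
    rw [← LinearMap.range_eq_top, ← hR, eq_top_iff]
    rintro ⟨y₀, y₁⟩ -
    -- Adding back the `Φ`-part of `A D` leaves the Vandermonde map, whose inverse is written out
    -- below by linear interpolation.
    have hM : ∀ D : ℂ × ℂ, (D.1 + (l₀ : ℂ) * D.2, D.1 + (l₁ : ℂ) * D.2) ∈ R := by
      intro D
      convert R.add_mem (LinearMap.mem_range_self A D) (hsurjΦ D) using 1
      refine Prod.ext ?_ ?_
      · show _ = _ - _ + _
        ring
      · show _ = _ - _ + _
        ring
    convert hM (y₀ - l₀ * ((y₁ - y₀) / (l₁ - l₀)), (y₁ - y₀) / (l₁ - l₀)) using 1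
    refine Prod.ext ?_ ?_
    · simp
    · simp only
      field_simp
      ring
  have hinj : Function.Injective A := LinearMap.injective_iff_surjective.2 hsurj
  have hAE : A (E₁, E₂) = 0 := by
    refine Prod.ext ?_ ?_
    · show _ - _ = _
      simp only [hΦ]
      rw [hE₀, sub_self]
      rfl
    · show _ - _ = _
      simp only [hΦ]
      rw [hE₁, sub_self]
      rfl
  have := hinj (hAE.trans (map_zero A).symm)
  simpa using this

end LinearSystem

/-! ### Transforms of the positive and negative parts of `x - J`. -/

section Exponential

variable {l x : ℝ} {s : ℂ}

lemma integral_expMeasure (hl : 0 < l) (f : ℝ → ℂ) :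
    ∫ j, f j ∂(expMeasure l) = ∫ j in Set.Ioi (0 : ℝ), (l : ℂ) * Complex.exp (-l * j) * f j := by
  have h1 : expMeasure l = volume.withDensity (fun j => ENNReal.ofReal (gammaPDFReal 1 l j)) := rfl
  rw [h1, integral_withDensity_eq_integral_toReal_smul
    (measurable_gammaPDFReal 1 l).ennreal_ofReal (by simp), ← integral_Ici_eq_integral_Ioi,
    ← integral_indicator measurableSet_Ici]
  congr 1
  funext j
  rw [ENNReal.toReal_ofReal (gammaPDFReal_nonneg one_pos hl j)]
  by_cases hj : 0 ≤ j
  · rw [Set.indicator_of_mem (Set.mem_Ici.2 hj), gammaPDFReal, if_pos hj]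
    simp
  · rw [Set.indicator_of_notMem (by simpa using hj), gammaPDFReal, if_neg hj]
    simp

/-- Keeping the factor `c` on the left includes `c = 0`, which is needed at `s = l`. -/
lemma mul_integral_exp_mul (c : ℂ) (x : ℝ) :
    c * ∫ j in (0 : ℝ)..x, Complex.exp (c * j) = Complex.exp (c * x) - 1 := by
  rcases eq_or_ne c 0 with rfl | hc
  · simp
  · rw [integral_exp_mul_complex hc]
    field_simp
    simp

lemma integrableOn_exp_mul_Ioc (c : ℂ) (x : ℝ) :
    IntegrableOn (fun j : ℝ => Complex.exp (c * j)) (Set.Ioc 0 x) :=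
  (Continuous.integrableOn_Icc (by fun_prop)).mono_set Set.Ioc_subset_Icc_self

lemma setIntegral_Ioi_split (hx : 0 ≤ x) {f g h : ℝ → ℂ}
    (hfg : ∀ j ∈ Set.Ioc 0 x, f j = g j) (hfh : ∀ j ∈ Set.Ioi x, f j = h j)
    (hg : IntegrableOn g (Set.Ioc 0 x)) (hh : IntegrableOn h (Set.Ioi x)) :
    ∫ j in Set.Ioi 0, f j = (∫ j in (0 : ℝ)..x, g j) + ∫ j in Set.Ioi x, h j := by
  rw [← Set.Ioc_union_Ioi_eq_Ioi hx, setIntegral_union (Set.Ioc_disjoint_Ioi le_rfl)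
    measurableSet_Ioi (hg.congr_fun (fun j hj => (hfg j hj).symm) measurableSet_Ioc)
    (hh.congr_fun (fun j hj => (hfh j hj).symm) measurableSet_Ioi),
    setIntegral_congr_fun measurableSet_Ioc hfg, setIntegral_congr_fun measurableSet_Ioi hfh,
    intervalIntegral.integral_of_le hx]

/-- Transform of the positive part of `x - J` for an exponential `J`. -/
lemma integral_exp_max_expMeasure (hl : 0 < l) (hx : 0 ≤ x) (s : ℂ) :
    ((l : ℂ) - s) * ∫ j, Complex.exp (-s * ((max (x - j) 0 : ℝ) : ℂ)) ∂(expMeasure l)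
      = l * Complex.exp (-s * x) - s * Complex.exp (-l * x) := by
  have hneg : (-(l : ℂ)).re < 0 := by simpa using hl
  have hl' : (l : ℂ) ≠ 0 := by exact_mod_cast hl.ne'
  rw [integral_expMeasure hl, setIntegral_Ioi_split hx
    (g := fun j => l * Complex.exp (-s * x) * Complex.exp ((s - l) * j))
    (h := fun j => l * Complex.exp (-l * j))]
  · rw [intervalIntegral.integral_const_mul, integral_const_mul, integral_exp_mul_complex_Ioi hneg]
    have h := mul_integral_exp_mul (s - l) x
    have he : Complex.exp (-s * x) * Complex.exp ((s - l) * x) = Complex.exp (-l * x) := by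
      rw [← Complex.exp_add]; congr 1; ring
    have h2 : (l : ℂ) * (-Complex.exp (-l * x) / -l) = Complex.exp (-l * x) := by field_simp
    rw [h2]
    linear_combination (-(l : ℂ)) * Complex.exp (-s * x) * h - l * he
  · intro j hj
    rw [max_eq_left (by linarith [hj.2]), mul_assoc, mul_assoc, ← Complex.exp_add,
      ← Complex.exp_add]
    congr 2
    push_cast
    ring
  · intro j hj
    rw [max_eq_right (by linarith [Set.mem_Ioi.1 hj])]
    simp
  · exact (integrableOn_exp_mul_Ioc _ _).const_mul _
  · exact (integrableOn_exp_mul_complex_Ioi hneg x).const_mul _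

/-- Transform of the negative part of `x - J` for an exponential `J`. -/
lemma integral_exp_min_expMeasure (hl : 0 < l) (hx : 0 ≤ x) (hs : s.re ≤ 0) :
    ((l : ℂ) - s) * ∫ j, Complex.exp (-s * ((min (x - j) 0 : ℝ) : ℂ)) ∂(expMeasure l)
      = (l - s) + s * Complex.exp (-l * x) := by
  -- Integrability of the tail `j > x`, where the integrand grows like `e^{(s-l)j}`; this is where
  -- `Re s ≤ 0` enters.
  have hneg : (s - (l : ℂ)).re < 0 := by simp; linarith
  have hne : s - (l : ℂ) ≠ 0 := fun h => by rw [h] at hneg; simp at hneg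
  rw [integral_expMeasure hl, setIntegral_Ioi_split hx
    (g := fun j => l * Complex.exp (-l * j))
    (h := fun j => l * Complex.exp (-s * x) * Complex.exp ((s - l) * j))]
  · rw [intervalIntegral.integral_const_mul, integral_const_mul, integral_exp_mul_complex_Ioi hneg]
    have h := mul_integral_exp_mul (-l) x
    have he : Complex.exp (-s * x) * Complex.exp ((s - l) * x) = Complex.exp (-l * x) := by
      rw [← Complex.exp_add]; congr 1; ring
    have h2 : (l - s) * (l * Complex.exp (-s * x) * (-Complex.exp ((s - l) * x) / (s - l)))
        = l * Complex.exp (-l * x) := by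
      rw [← he]; field_simp; ring
    rw [mul_add, h2]
    linear_combination (-((l : ℂ) - s)) * h
  · intro j hj
    rw [min_eq_right (by linarith [hj.2])]
    simp
  · intro j hj
    rw [min_eq_left (by linarith [Set.mem_Ioi.1 hj]), mul_assoc, mul_assoc, ← Complex.exp_add,
      ← Complex.exp_add]
    congr 2
    push_cast
    ring
  · exact (integrableOn_exp_mul_Ioc _ _).const_mul _
  · exact (integrableOn_exp_mul_complex_Ioi hneg x).const_mul _

end Exponential

/-! ### One step of the recursion from a deterministic state. -/

section OneStep

variable {Ω : Type*} [MeasurableSpace Ω] {P : Measure Ω}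

lemma norm_exp_neg_mul_le_one {s : ℂ} {x : ℝ} (hs : 0 ≤ s.re) (hx : 0 ≤ x) :
    ‖Complex.exp (-s * (x : ℂ))‖ ≤ 1 := by
  rw [Complex.norm_exp, Real.exp_le_one_iff, Complex.re_mul_ofReal, Complex.neg_re]
  nlinarith

lemma norm_exp_neg_mul_le_one' {s : ℂ} {x : ℝ} (hs : s.re ≤ 0) (hx : x ≤ 0) :
    ‖Complex.exp (-s * (x : ℂ))‖ ≤ 1 := by
  rw [Complex.norm_exp, Real.exp_le_one_iff, Complex.re_mul_ofReal, Complex.neg_re]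
  nlinarith

/-- Fubini for a bounded function of two independent random elements. -/
lemma integral_comp_of_indepFun [IsProbabilityMeasure P] {α β : Type*} [MeasurableSpace α]
    [MeasurableSpace β]
    {X : Ω → α} {Y : Ω → β} (hX : Measurable X) (hY : Measurable Y) (hXY : IndepFun X Y P)
    {f : α × β → ℂ} (hf : Measurable f) {c : ℝ} (hc : ∀ z, ‖f z‖ ≤ c) :
    ∫ ω, f (X ω, Y ω) ∂P = ∫ ω, ∫ ω', f (X ω, Y ω') ∂P ∂P := by
  have : IsProbabilityMeasure (P.map X) := Measure.isProbabilityMeasure_map hX.aemeasurable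
  have : IsProbabilityMeasure (P.map Y) := Measure.isProbabilityMeasure_map hY.aemeasurable
  have h1 : ∫ ω, f (X ω, Y ω) ∂P = ∫ z, f z ∂(P.map (fun ω => (X ω, Y ω))) :=
    (integral_map (hX.prodMk hY).aemeasurable hf.aestronglyMeasurable).symm
  rw [h1, hXY.map_prod_eq_prod_map_map hX.aemeasurable hY.aemeasurable,
    integral_prod _ (Integrable.of_bound hf.aestronglyMeasurable c (ae_of_all _ hc)),
    integral_map hX.aemeasurable
      hf.stronglyMeasurable.integral_prod_right'.aestronglyMeasurable]
  refine integral_congr_ae (ae_of_all _ fun ω => ?_)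
  exact integral_map hY.aemeasurable (hf.comp measurable_prodMk_left).aestronglyMeasurable

/-- Integrating out an independent exponential variable on an event. -/
lemma setIntegral_comp_exp [IsProbabilityMeasure P] {β : Type*} [MeasurableSpace β] {l : ℝ}
    {D : Ω → β} {J : Ω → ℝ} (hD : Measurable D) (hJ : Measurable J)
    (hlaw : HasLaw J (expMeasure l) P) (hDJ : IndepFun D J P)
    {φ : β → ℝ} (hφ : Measurable φ) {A : Set β} (hA : MeasurableSet A)
    {g : ℝ → ℂ} (hg : Measurable g) {c : ℝ} (hc : ∀ y, ‖g y‖ ≤ c) :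
    ∫ ω in D ⁻¹' A, g (φ (D ω) - J ω) ∂P
      = ∫ ω in D ⁻¹' A, ∫ j, g (φ (D ω) - j) ∂(expMeasure l) ∂P := by
  -- The event is absorbed into an indicator, so that Fubini applies to one bounded function of the
  -- independent pair `(D, J)`.
  have hm : Measurable (fun z : β × ℝ => (A ×ˢ Set.univ).indicator
      (fun z : β × ℝ => g (φ z.1 - z.2)) z) :=
    Measurable.indicator (by fun_prop) (hA.prod MeasurableSet.univ)
  have h := integral_comp_of_indepFun hD hJ hDJ hm (c := c) fun z => by
    refine (norm_indicator_le_norm_self _ _).trans (hc _)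
  rw [← integral_indicator (hD hA), ← integral_indicator (hD hA)]
  refine Eq.trans (integral_congr_ae (ae_of_all _ fun ω => ?_))
    (h.trans (integral_congr_ae (ae_of_all _ fun ω => ?_)))
  · by_cases hω : D ω ∈ A <;> simp [Set.indicator, hω]
  by_cases hω : D ω ∈ A
  · simp only [Set.indicator, Set.mem_preimage, hω, Set.mem_prod, Set.mem_univ, and_true, if_true]
    rw [← hlaw.map_eq]
    exact (integral_map hJ.aemeasurable
      (by fun_prop : Measurable fun j => g (φ (D ω) - j)).aestronglyMeasurable).symm
  · simp [Set.indicator, hω]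

lemma integrable_exp_neg_mul [IsProbabilityMeasure P] {X : Ω → ℝ} (hX : Measurable X)
    (h0 : ∀ᵐ ω ∂P, 0 ≤ X ω) {s : ℂ}
    (hs : 0 ≤ s.re) : Integrable (fun ω => Complex.exp (-s * (X ω : ℂ))) P :=
  Integrable.of_bound (Measurable.aestronglyMeasurable (by fun_prop)) 1
    (h0.mono fun _ h => norm_exp_neg_mul_le_one hs h)

lemma mul_setIntegral_exp_max [IsProbabilityMeasure P] {β : Type*} [MeasurableSpace β] {l : ℝ}
    (hl : 0 < l)
    {D : Ω → β} {J : Ω → ℝ} (hD : Measurable D) (hJ : Measurable J)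
    (hlaw : HasLaw J (expMeasure l) P) (hDJ : IndepFun D J P)
    {φ : β → ℝ} (hφ : Measurable φ) (hφ0 : ∀ᵐ ω ∂P, 0 ≤ φ (D ω)) {A : Set β}
    (hA : MeasurableSet A) {s : ℂ} (hs : 0 ≤ s.re) :
    ((l : ℂ) - s) * ∫ ω in D ⁻¹' A, Complex.exp (-s * ((max (φ (D ω) - J ω) 0 : ℝ) : ℂ)) ∂P
      = l * ∫ ω in D ⁻¹' A, Complex.exp (-s * (φ (D ω) : ℂ)) ∂P
        - s * ∫ ω in D ⁻¹' A, Complex.exp (-l * (φ (D ω) : ℂ)) ∂P := by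
  rw [setIntegral_comp_exp hD hJ hlaw hDJ hφ hA
    (g := fun y => Complex.exp (-s * ((max y 0 : ℝ) : ℂ))) (by fun_prop) (c := 1)
    fun y => norm_exp_neg_mul_le_one hs (le_max_right _ _), ← integral_const_mul,
    ← integral_const_mul, ← integral_const_mul, ← integral_sub]
  · refine setIntegral_congr_ae (hD hA) ?_
    filter_upwards [hφ0] with ω hω _
    exact integral_exp_max_expMeasure hl hω s
  · exact ((integrable_exp_neg_mul (hφ.comp hD) hφ0 hs).const_mul _).integrableOn
  · exact ((integrable_exp_neg_mul (s := (l : ℂ)) (hφ.comp hD) hφ0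
      (by simpa using hl.le)).const_mul _).integrableOn

lemma mul_setIntegral_exp_min [IsProbabilityMeasure P] {β : Type*} [MeasurableSpace β] {l : ℝ}
    (hl : 0 < l)
    {D : Ω → β} {J : Ω → ℝ} (hD : Measurable D) (hJ : Measurable J)
    (hlaw : HasLaw J (expMeasure l) P) (hDJ : IndepFun D J P)
    {φ : β → ℝ} (hφ : Measurable φ) (hφ0 : ∀ᵐ ω ∂P, 0 ≤ φ (D ω)) {A : Set β}
    (hA : MeasurableSet A) {s : ℂ} (hs : s.re ≤ 0) :
    ((l : ℂ) - s) * ∫ ω in D ⁻¹' A, Complex.exp (-s * ((min (φ (D ω) - J ω) 0 : ℝ) : ℂ)) ∂P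
      = (l - s) * P.real (D ⁻¹' A)
        + s * ∫ ω in D ⁻¹' A, Complex.exp (-l * (φ (D ω) : ℂ)) ∂P := by
  have hone : ((l : ℂ) - s) * P.real (D ⁻¹' A) = ∫ ω in D ⁻¹' A, ((l : ℂ) - s) ∂P := by
    rw [setIntegral_const, Complex.real_smul, mul_comm]
  rw [setIntegral_comp_exp hD hJ hlaw hDJ hφ hA
    (g := fun y => Complex.exp (-s * ((min y 0 : ℝ) : ℂ))) (by fun_prop) (c := 1)
    fun y => norm_exp_neg_mul_le_one' hs (min_le_right _ _), hone, ← integral_const_mul,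
    ← integral_const_mul, ← integral_add]
  · refine setIntegral_congr_ae (hD hA) ?_
    filter_upwards [hφ0] with ω hω _
    exact integral_exp_min_expMeasure hl hω hs
  · exact (integrable_const _).integrableOn
  · exact ((integrable_exp_neg_mul (s := (l : ℂ)) (hφ.comp hD) hφ0
      (by simpa using hl.le)).const_mul _).integrableOn

variable {a₀ a₁ l₀ l₁ : ℝ} {B T J₀ J₁ : Ω → ℝ}

lemma measurable_step : Measurable (fun q : ℝ × ℝ × ℝ × ℝ × ℝ =>
    step a₀ a₁ q.1 q.2.1 q.2.2.1 q.2.2.2.1 q.2.2.2.2) := by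
  unfold step
  exact Measurable.ite (measurableSet_lt (by fun_prop) (by fun_prop)) (by fun_prop) (by fun_prop)

lemma step_nonneg (w b t j₀ j₁ : ℝ) : 0 ≤ step a₀ a₁ w b t j₀ j₁ := by
  unfold step
  split_ifs <;> exact le_max_right _ _

/-- The branch is chosen by the input alone, so two states fed the same input follow the same
branch, and the positive part is 1-Lipschitz. -/
lemma abs_step_sub_le (ha₀ : a₀ ∈ Set.Ioo (0 : ℝ) 1) (ha₁ : a₁ ∈ Set.Ioo (0 : ℝ) 1)
    (w w' b t j₀ j₁ : ℝ) :
    |step a₀ a₁ w b t j₀ j₁ - step a₀ a₁ w' b t j₀ j₁| ≤ max a₀ a₁ * |w - w'| := by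
  unfold step
  split_ifs
  · refine (abs_max_sub_max_le_abs _ _ _).trans ?_
    rw [show a₀ * w + b - j₀ - (a₀ * w' + b - j₀) = a₀ * (w - w') by ring, abs_mul,
      abs_of_pos ha₀.1]
    gcongr
    exact le_max_left _ _
  · refine (abs_max_sub_max_le_abs _ _ _).trans ?_
    rw [show a₁ * w + t - j₁ - (a₁ * w' + t - j₁) = a₁ * (w - w') by ring, abs_mul,
      abs_of_pos ha₁.1]
    gcongr
    exact le_max_right _ _

namespace IsInput

lemma indep_J₀ (h : IsInput P l₀ l₁ B T J₀ J₁) : IndepFun (fun ω => (B ω, T ω)) J₀ P :=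
  h.indep_BT_J.comp measurable_id measurable_fst

lemma indep_J₁ (h : IsInput P l₀ l₁ B T J₀ J₁) : IndepFun (fun ω => (B ω, T ω)) J₁ P :=
  h.indep_BT_J.comp measurable_id measurable_snd

lemma measurable_input (h : IsInput P l₀ l₁ B T J₀ J₁) :
    Measurable (fun ω => (B ω, T ω, J₀ ω, J₁ ω)) :=
  h.measurable_B.prodMk (h.measurable_T.prodMk (h.measurable_J₀.prodMk h.measurable_J₁))

lemma measurable_step_input (h : IsInput P l₀ l₁ B T J₀ J₁) (w : ℝ) :
    Measurable (fun ω => step a₀ a₁ w (B ω) (T ω) (J₀ ω) (J₁ ω)) :=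
  measurable_step.comp (measurable_const.prodMk h.measurable_input)

lemma measurableSet_lt (h : IsInput P l₀ l₁ B T J₀ J₁) : MeasurableSet {ω | B ω < T ω} :=
  _root_.measurableSet_lt h.measurable_B h.measurable_T

lemma compl_setOf_lt {Ω : Type*} {B T : Ω → ℝ} : {ω | B ω < T ω}ᶜ = {ω | T ω ≤ B ω} := by
  ext ω
  simp

lemma integral_split (h : IsInput P l₀ l₁ B T J₀ J₁) {f : Ω → ℂ} (hf : Integrable f P) :
    ∫ ω, f ω ∂P = (∫ ω in {ω | B ω < T ω}, f ω ∂P) + ∫ ω in {ω | T ω ≤ B ω}, f ω ∂P := by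
  rw [← compl_setOf_lt, integral_add_compl h.measurableSet_lt hf]

lemma setIntegral_exp_B (w : ℝ) (a : ℝ) (s : ℂ) :
    ∫ ω in {ω | B ω < T ω}, Complex.exp (-s * ((a * w + B ω : ℝ) : ℂ)) ∂P
      = chi P B T s * Complex.exp (-(a * s) * w) := by
  rw [chi, mul_comm (integral _ _), ← integral_const_mul]
  congr 1
  funext ω
  rw [← Complex.exp_add]
  congr 1
  push_cast
  ring

lemma setIntegral_exp_T (w : ℝ) (a : ℝ) (s : ℂ) :
    ∫ ω in {ω | T ω ≤ B ω}, Complex.exp (-s * ((a * w + T ω : ℝ) : ℂ)) ∂P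
      = psi P B T s * Complex.exp (-(a * s) * w) := by
  rw [psi, mul_comm (integral _ _), ← integral_const_mul]
  congr 1
  funext ω
  rw [← Complex.exp_add]
  congr 1
  push_cast
  ring

/-- One step of the recursion started from a fixed waiting time. -/
lemma integral_exp_step [IsProbabilityMeasure P] (h : IsInput P l₀ l₁ B T J₀ J₁) (ha₀ : 0 < a₀)
    (ha₁ : 0 < a₁)
    (hl₀ : 0 < l₀) (hl₁ : 0 < l₁) {w : ℝ} (hw : 0 ≤ w) {s : ℂ} (hs : 0 ≤ s.re) :
    ((l₀ : ℂ) - s) * ((l₁ : ℂ) - s)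
        * ∫ ω, Complex.exp (-s * (step a₀ a₁ w (B ω) (T ω) (J₀ ω) (J₁ ω) : ℂ)) ∂P
      = balance a₀ a₁ l₀ l₁ (chi P B T) (psi P B T) (fun x => Complex.exp (-x * w)) s := by
  have e0 := mul_setIntegral_exp_max hl₀ (h.measurable_B.prodMk h.measurable_T) h.measurable_J₀
    h.law_J₀ h.indep_J₀ (φ := fun q => a₀ * w + q.1) (by fun_prop)
    (h.nonneg_B.mono fun ω hω => by positivity) (A := {q | q.1 < q.2})
    (_root_.measurableSet_lt measurable_fst measurable_snd) hs
  have e1 := mul_setIntegral_exp_max hl₁ (h.measurable_B.prodMk h.measurable_T) h.measurable_J₁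
    h.law_J₁ h.indep_J₁ (φ := fun q => a₁ * w + q.2) (by fun_prop)
    (h.nonneg_T.mono fun ω hω => by positivity) (A := {q | q.2 ≤ q.1})
    (measurableSet_le measurable_snd measurable_fst) hs
  simp only [Set.preimage_ofPred_eq] at e0 e1
  rw [setIntegral_exp_B, setIntegral_exp_B] at e0
  rw [setIntegral_exp_T, setIntegral_exp_T] at e1
  rw [h.integral_split (integrable_exp_neg_mul (h.measurable_step_input w)
    (ae_of_all _ fun _ => step_nonneg _ _ _ _ _) hs)]
  have c0 : ∫ ω in {ω | B ω < T ω},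
      Complex.exp (-s * (step a₀ a₁ w (B ω) (T ω) (J₀ ω) (J₁ ω) : ℂ)) ∂P
      = ∫ ω in {ω | B ω < T ω},
        Complex.exp (-s * ((max (a₀ * w + B ω - J₀ ω) 0 : ℝ) : ℂ)) ∂P :=
    setIntegral_congr_fun h.measurableSet_lt fun ω hω => by
      simp only [step, if_pos (show B ω < T ω from hω)]
  have c1 : ∫ ω in {ω | T ω ≤ B ω},
      Complex.exp (-s * (step a₀ a₁ w (B ω) (T ω) (J₀ ω) (J₁ ω) : ℂ)) ∂P
      = ∫ ω in {ω | T ω ≤ B ω},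
        Complex.exp (-s * ((max (a₁ * w + T ω - J₁ ω) 0 : ℝ) : ℂ)) ∂P :=
    setIntegral_congr_fun (measurableSet_le h.measurable_T h.measurable_B) fun ω hω => by
      simp only [step, if_neg (not_lt.2 (show T ω ≤ B ω from hω))]
  rw [c0, c1, balance]
  linear_combination ((l₁ : ℂ) - s) * e0 + ((l₀ : ℂ) - s) * e1

/-- The negative parts in one step of the recursion started from a fixed waiting time. -/
lemma negTransform_const [IsProbabilityMeasure P] (h : IsInput P l₀ l₁ B T J₀ J₁) (ha₀ : 0 < a₀)
    (ha₁ : 0 < a₁)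
    (hl₀ : 0 < l₀) (hl₁ : 0 < l₁) {w : ℝ} (hw : 0 ≤ w) {s : ℂ} (hs : s.re ≤ 0) :
    ((l₀ : ℂ) - s) * ((l₁ : ℂ) - s) * (1 - negTransform P a₀ a₁ (fun _ => w) B T J₀ J₁ s)
      = -s * ((l₁ : ℂ) - s) * (chi P B T l₀ * Complex.exp (-(a₀ * l₀) * w))
        - s * ((l₀ : ℂ) - s) * (psi P B T l₁ * Complex.exp (-(a₁ * l₁) * w)) := by
  have e0 := mul_setIntegral_exp_min hl₀ (h.measurable_B.prodMk h.measurable_T) h.measurable_J₀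
    h.law_J₀ h.indep_J₀ (φ := fun q => a₀ * w + q.1) (by fun_prop)
    (h.nonneg_B.mono fun ω hω => by positivity) (A := {q | q.1 < q.2})
    (_root_.measurableSet_lt measurable_fst measurable_snd) hs
  have e1 := mul_setIntegral_exp_min hl₁ (h.measurable_B.prodMk h.measurable_T) h.measurable_J₁
    h.law_J₁ h.indep_J₁ (φ := fun q => a₁ * w + q.2) (by fun_prop)
    (h.nonneg_T.mono fun ω hω => by positivity) (A := {q | q.2 ≤ q.1})
    (measurableSet_le measurable_snd measurable_fst) hs
  simp only [Set.preimage_ofPred_eq] at e0 e1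
  rw [setIntegral_exp_B] at e0
  rw [setIntegral_exp_T] at e1
  have hp : (P.real {ω | B ω < T ω} : ℂ) + (P.real {ω | T ω ≤ B ω} : ℂ) = 1 := by
    have := probReal_add_probReal_compl (μ := P) h.measurableSet_lt
    rw [compl_setOf_lt] at this
    exact_mod_cast this
  rw [negTransform]
  linear_combination (-((l₁ : ℂ) - s)) * e0 - ((l₀ : ℂ) - s) * e1
    - ((l₀ : ℂ) - s) * ((l₁ : ℂ) - s) * hp

/-- The dominating weights are the probabilities of the two complementary events. -/
lemma subStochastic [IsProbabilityMeasure P] (h : IsInput P l₀ l₁ B T J₀ J₁) :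
    SubStochastic (chi P B T) (psi P B T) := by
  refine ⟨P.real {ω | B ω < T ω}, P.real {ω | T ω ≤ B ω}, measureReal_nonneg, measureReal_nonneg,
    ?_, fun s hs => ⟨?_, ?_⟩⟩
  · have := probReal_add_probReal_compl (μ := P) h.measurableSet_lt
    rw [compl_setOf_lt] at this
    exact this.le
  · rw [← one_mul (P.real _)]
    refine norm_setIntegral_le_of_norm_le_const_ae (measure_lt_top _ _) ?_
    exact ae_restrict_of_ae (h.nonneg_B.mono fun ω hω => norm_exp_neg_mul_le_one hs hω)
  · rw [← one_mul (P.real _)]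
    refine norm_setIntegral_le_of_norm_le_const_ae (measure_lt_top _ _) ?_
    exact ae_restrict_of_ae (h.nonneg_T.mono fun ω hω => norm_exp_neg_mul_le_one hs hω)

end IsInput

end OneStep

/-! ### One step from an independent random state; regularity of transforms. -/

section RandomStart

variable {Ω : Type*} [MeasurableSpace Ω] {P : Measure Ω} {a₀ a₁ l₀ l₁ : ℝ}
  {W B T J₀ J₁ : Ω → ℝ}

lemma ofReal_mul_re_nonneg {a : ℝ} (ha : 0 < a) {s : ℂ} (hs : 0 ≤ s.re) :
    0 ≤ ((a : ℂ) * s).re := by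
  rw [Complex.re_ofReal_mul]
  positivity

/-- `balance` is linear in `F` and evaluates it at four points, all in the closed right half-plane,
so it commutes with averaging over the initial state. -/
lemma integral_balance (ha₀ : 0 < a₀) (ha₁ : 0 < a₁) (hl₀ : 0 < l₀) (hl₁ : 0 < l₁)
    {χ ψ : ℂ → ℂ} {G : Ω → ℂ → ℂ}
    (hG : ∀ x : ℂ, 0 ≤ x.re → Integrable (fun ω => G ω x) P) {s : ℂ} (hs : 0 ≤ s.re) :
    ∫ ω, balance a₀ a₁ l₀ l₁ χ ψ (G ω) s ∂P
      = balance a₀ a₁ l₀ l₁ χ ψ (fun x => ∫ ω, G ω x ∂P) s := by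
  have i₀ := hG _ (ofReal_mul_re_nonneg ha₀ hs)
  have i₁ := hG _ (ofReal_mul_re_nonneg ha₁ hs)
  have k₀ := hG _ (ofReal_mul_re_nonneg (s := (l₀ : ℂ)) ha₀ (by simpa using hl₀.le))
  have k₁ := hG _ (ofReal_mul_re_nonneg (s := (l₁ : ℂ)) ha₁ (by simpa using hl₁.le))
  simp only [balance]
  rw [integral_sub, integral_sub, integral_add]
  · simp only [integral_const_mul]
  · exact i₀.const_mul _
  · exact i₁.const_mul _
  · exact (i₀.const_mul _).add (i₁.const_mul _)
  · exact (k₀.const_mul _).const_mul _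
  · exact ((i₀.const_mul _).add (i₁.const_mul _)).sub ((k₀.const_mul _).const_mul _)
  · exact (k₁.const_mul _).const_mul _

lemma norm_lst_le_one [IsProbabilityMeasure P] (h0 : ∀ᵐ ω ∂P, 0 ≤ W ω) {s : ℂ} (hs : 0 ≤ s.re) :
    ‖lst P W s‖ ≤ 1 := by
  have := norm_integral_le_of_norm_le_const (μ := P)
    (h0.mono fun ω hω => norm_exp_neg_mul_le_one hs hω)
  simpa [lst] using this

lemma continuousOn_lst [IsProbabilityMeasure P] (hW : Measurable W) (h0 : ∀ᵐ ω ∂P, 0 ≤ W ω) :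
    ContinuousOn (lst P W) {s | 0 ≤ s.re} := by
  unfold lst
  refine MeasureTheory.continuousOn_of_dominated (bound := fun _ => 1) (fun s _ => ?_)
    (fun s hs => ?_) (integrable_const 1) (ae_of_all _ fun ω => ?_)
  · exact Measurable.aestronglyMeasurable (by fun_prop)
  · exact h0.mono fun ω hω => norm_exp_neg_mul_le_one hs hω
  · exact Continuous.continuousOn (by fun_prop)

/-- The transform at `s` is the complex moment generating function at `-s`, and for `W ≥ 0` all
negative exponents are integrable. -/
lemma differentiableOn_lst [IsProbabilityMeasure P] (hW : Measurable W)
    (h0 : ∀ᵐ ω ∂P, 0 ≤ W ω) : DifferentiableOn ℂ (lst P W) {s | 0 < s.re} := by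
  have hsub : Set.Iio (0 : ℝ) ⊆ interior (integrableExpSet W P) := by
    refine interior_maximal (fun t ht => ?_) isOpen_Iio
    refine Integrable.of_bound (Measurable.aestronglyMeasurable (by fun_prop)) 1
      (h0.mono fun ω hω => ?_)
    rw [Real.norm_of_nonneg (Real.exp_nonneg _), Real.exp_le_one_iff]
    exact mul_nonpos_of_nonpos_of_nonneg (le_of_lt ht) hω
  have h := differentiableOn_complexMGF (X := W) (μ := P)
  exact h.comp (differentiable_neg.differentiableOn) fun s hs => hsub (by simpa using hs)

namespace IsInput

variable [IsProbabilityMeasure P]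

/-- One step of the recursion started from an independent waiting time. -/
lemma lst_step (h : IsInput P l₀ l₁ B T J₀ J₁) (ha₀ : 0 < a₀) (ha₁ : 0 < a₁)
    (hl₀ : 0 < l₀) (hl₁ : 0 < l₁) (hW : Measurable W) (h0 : ∀ᵐ ω ∂P, 0 ≤ W ω)
    (hind : IndepFun W (fun ω => (B ω, T ω, J₀ ω, J₁ ω)) P) {s : ℂ} (hs : 0 ≤ s.re) :
    ((l₀ : ℂ) - s) * ((l₁ : ℂ) - s)
        * lst P (fun ω => step a₀ a₁ (W ω) (B ω) (T ω) (J₀ ω) (J₁ ω)) s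
      = balance a₀ a₁ l₀ l₁ (chi P B T) (psi P B T) (lst P W) s := by
  have hm : Measurable (fun q : ℝ × ℝ × ℝ × ℝ × ℝ =>
      Complex.exp (-s * (step a₀ a₁ q.1 q.2.1 q.2.2.1 q.2.2.2.1 q.2.2.2.2 : ℂ))) := by
    have := measurable_step (a₀ := a₀) (a₁ := a₁)
    fun_prop
  have e := integral_comp_of_indepFun hW h.measurable_input hind hm (c := 1)
    fun q => norm_exp_neg_mul_le_one hs (step_nonneg _ _ _ _ _)
  simp only at e
  rw [lst, e, ← integral_const_mul]
  refine Eq.trans (integral_congr_ae (h0.mono fun ω hω =>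
    h.integral_exp_step ha₀ ha₁ hl₀ hl₁ hω hs)) ?_
  exact integral_balance ha₀ ha₁ hl₀ hl₁ (fun x hx => integrable_exp_neg_mul hW h0 hx) hs

/-- The negative part of the increment that leads to the next waiting time. -/
def negStep (a₀ a₁ w b t j₀ j₁ : ℝ) : ℝ :=
  if b < t then min (a₀ * w + b - j₀) 0 else min (a₁ * w + t - j₁) 0

lemma negStep_nonpos (w b t j₀ j₁ : ℝ) : negStep a₀ a₁ w b t j₀ j₁ ≤ 0 := by
  unfold negStep
  split_ifs <;> exact min_le_right _ _

lemma measurable_negStep : Measurable (fun q : ℝ × ℝ × ℝ × ℝ × ℝ =>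
    negStep a₀ a₁ q.1 q.2.1 q.2.2.1 q.2.2.2.1 q.2.2.2.2) := by
  unfold negStep
  exact Measurable.ite (_root_.measurableSet_lt (by fun_prop) (by fun_prop)) (by fun_prop)
    (by fun_prop)

lemma negTransform_eq_integral (h : IsInput P l₀ l₁ B T J₀ J₁) (hW : Measurable W) {s : ℂ}
    (hs : s.re ≤ 0) :
    negTransform P a₀ a₁ W B T J₀ J₁ s
      = ∫ ω, Complex.exp (-s * (negStep a₀ a₁ (W ω) (B ω) (T ω) (J₀ ω) (J₁ ω) : ℂ)) ∂P := by
  have hm : Measurable (fun ω => negStep a₀ a₁ (W ω) (B ω) (T ω) (J₀ ω) (J₁ ω)) :=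
    measurable_negStep.comp (hW.prodMk h.measurable_input)
  rw [h.integral_split (Integrable.of_bound (Measurable.aestronglyMeasurable (by fun_prop)) 1
    (ae_of_all _ fun ω => norm_exp_neg_mul_le_one' hs (negStep_nonpos _ _ _ _ _))), negTransform]
  congr 1
  · exact setIntegral_congr_fun h.measurableSet_lt fun ω hω => by
      simp only [negStep, if_pos (show B ω < T ω from hω)]
  · exact setIntegral_congr_fun (measurableSet_le h.measurable_T h.measurable_B) fun ω hω => by
      simp only [negStep, if_neg (not_lt.2 (show T ω ≤ B ω from hω))]

lemma norm_negTransform_le_one (h : IsInput P l₀ l₁ B T J₀ J₁) (hW : Measurable W) {s : ℂ}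
    (hs : s.re ≤ 0) : ‖negTransform P a₀ a₁ W B T J₀ J₁ s‖ ≤ 1 := by
  rw [h.negTransform_eq_integral hW hs]
  have := norm_integral_le_of_norm_le_const (μ := P)
    (ae_of_all _ fun ω => norm_exp_neg_mul_le_one' hs
      (negStep_nonpos (a₀ := a₀) (a₁ := a₁) (W ω) (B ω) (T ω) (J₀ ω) (J₁ ω)))
  simpa using this

/-- The negative parts in one step of the recursion started from an independent waiting time. -/
lemma negTransform_eq (h : IsInput P l₀ l₁ B T J₀ J₁) (ha₀ : 0 < a₀) (ha₁ : 0 < a₁)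
    (hl₀ : 0 < l₀) (hl₁ : 0 < l₁) (hW : Measurable W) (h0 : ∀ᵐ ω ∂P, 0 ≤ W ω)
    (hind : IndepFun W (fun ω => (B ω, T ω, J₀ ω, J₁ ω)) P) {s : ℂ} (hs : s.re ≤ 0) :
    ((l₀ : ℂ) - s) * ((l₁ : ℂ) - s) * (1 - negTransform P a₀ a₁ W B T J₀ J₁ s)
      = s * const₁ a₀ a₁ l₀ l₁ (chi P B T) (psi P B T) 1 (lst P W)
        + s ^ 2 * const₂ a₀ a₁ l₀ l₁ (chi P B T) (psi P B T) 1 (lst P W) := by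
  have hm : Measurable (fun q : ℝ × ℝ × ℝ × ℝ × ℝ =>
      Complex.exp (-s * (negStep a₀ a₁ q.1 q.2.1 q.2.2.1 q.2.2.2.1 q.2.2.2.2 : ℂ))) := by
    have := measurable_negStep (a₀ := a₀) (a₁ := a₁)
    fun_prop
  have e := integral_comp_of_indepFun hW h.measurable_input hind hm (c := 1)
    fun q => norm_exp_neg_mul_le_one' hs (negStep_nonpos _ _ _ _ _)
  simp only at e
  have hint : Integrable (fun ω => ∫ ω', Complex.exp
      (-s * (negStep a₀ a₁ (W ω) (B ω') (T ω') (J₀ ω') (J₁ ω') : ℂ)) ∂P) P := by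
    refine Integrable.of_bound (StronglyMeasurable.aestronglyMeasurable ?_) 1
      (ae_of_all _ fun ω => ?_)
    · have hf : Measurable (fun z : Ω × Ω => Complex.exp
          (-s * (negStep a₀ a₁ (W z.1) (B z.2) (T z.2) (J₀ z.2) (J₁ z.2) : ℂ))) :=
        hm.comp ((hW.comp measurable_fst).prodMk (h.measurable_input.comp measurable_snd))
      exact hf.stronglyMeasurable.integral_prod_right'
    · have := norm_integral_le_of_norm_le_const (μ := P)
        (ae_of_all _ fun ω' => norm_exp_neg_mul_le_one' hs
          (negStep_nonpos (a₀ := a₀) (a₁ := a₁) (W ω) (B ω') (T ω') (J₀ ω') (J₁ ω')))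
      simpa using this
  have hone : (1 : ℂ) = ∫ _ω, (1 : ℂ) ∂P := by simp
  have k₀ := integrable_exp_neg_mul hW h0
    (ofReal_mul_re_nonneg (s := (l₀ : ℂ)) ha₀ (by simpa using hl₀.le))
  have k₁ := integrable_exp_neg_mul hW h0
    (ofReal_mul_re_nonneg (s := (l₁ : ℂ)) ha₁ (by simpa using hl₁.le))
  rw [h.negTransform_eq_integral hW hs, e]
  nth_rewrite 1 [hone]
  rw [← integral_sub (integrable_const 1) hint, ← integral_const_mul]
  refine Eq.trans (integral_congr_ae (h0.mono fun ω hω => ?_)) (Eq.trans (integral_sub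
    ((k₀.const_mul (chi P B T l₀)).const_mul (-s * ((l₁ : ℂ) - s)))
    ((k₁.const_mul (psi P B T l₁)).const_mul (s * ((l₀ : ℂ) - s)))) ?_)
  · have := h.negTransform_const ha₀ ha₁ hl₀ hl₁ hω hs
    rw [h.negTransform_eq_integral measurable_const hs] at this
    exact this
  · simp only [integral_const_mul, const₁, const₂, lst]
    ring

end IsInput

end RandomStart

/-! ### Solutions of the functional equation obtained by summing along the recursion. -/

section Iteration

variable {a₀ a₁ l₀ l₁ : ℝ} {χ ψ : ℂ → ℂ} {r : ℂ}

/-- Summing the transforms along the recursion solves the functional equation. -/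
lemma isSolution_tsum (ha₀ : 0 < a₀) (ha₁ : 0 < a₁) (hl₀ : 0 < l₀) (hl₁ : 0 < l₁)
    {v : ℕ → ℂ → ℂ}
    (hv : ∀ n, ∀ s : ℂ, 0 ≤ s.re →
      ((l₀ : ℂ) - s) * ((l₁ : ℂ) - s) * v (n + 1) s = balance a₀ a₁ l₀ l₁ χ ψ (v n) s)
    (hsum : ∀ s : ℂ, 0 ≤ s.re → Summable (fun n => r ^ n * v n s)) :
    IsSolution a₀ a₁ l₀ l₁ χ ψ r (v 0) (fun s => ∑' n, r ^ n * v n s) := by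
  intro s hs
  have i₀ := (hsum _ (ofReal_mul_re_nonneg ha₀ hs)).hasSum
  have i₁ := (hsum _ (ofReal_mul_re_nonneg ha₁ hs)).hasSum
  have k₀ := (hsum _ (ofReal_mul_re_nonneg (s := (l₀ : ℂ)) ha₀ (by simpa using hl₀.le))).hasSum
  have k₁ := (hsum _ (ofReal_mul_re_nonneg (s := (l₁ : ℂ)) ha₁ (by simpa using hl₁.le))).hasSum
  have hb : HasSum (fun n => r ^ n * balance a₀ a₁ l₀ l₁ χ ψ (v n) s)
      (balance a₀ a₁ l₀ l₁ χ ψ (fun s => ∑' n, r ^ n * v n s) s) := by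
    refine ((((i₀.mul_left ((l₀ : ℂ) * ((l₁ : ℂ) - s) * χ s)).add
      (i₁.mul_left ((l₁ : ℂ) * ((l₀ : ℂ) - s) * ψ s))).sub
      ((k₀.mul_left (χ l₀)).mul_left (s * ((l₁ : ℂ) - s)))).sub
      ((k₁.mul_left (ψ l₁)).mul_left (s * ((l₀ : ℂ) - s)))).congr_fun fun n => ?_
    simp only [balance]
    ring
  have hF : (∑' n, r ^ n * v n s) - v 0 s = ∑' n, r ^ (n + 1) * v (n + 1) s := by
    rw [(hsum s hs).tsum_eq_zero_add]
    simp
  simp only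
  rw [hF, ← hb.tsum_eq, ← tsum_mul_left, ← tsum_mul_left]
  refine tsum_congr fun n => ?_
  rw [← hv n s hs]
  ring

variable {Ω : Type*} [MeasurableSpace Ω] {P : Measure Ω} [IsProbabilityMeasure P]
  {B T J₀ J₁ : Ω → ℝ}

/-- `E[e^{-s W_n}]` as a function of the starting point `w` of the recursion, computed by
conditioning on the first step. -/
def startTransform (P : Measure Ω) (a₀ a₁ : ℝ) (B T J₀ J₁ : Ω → ℝ) : ℕ → ℝ → ℂ → ℂ
  | 0, w, s => Complex.exp (-s * (w : ℂ))
  | n + 1, w, s => ∫ ω, startTransform P a₀ a₁ B T J₀ J₁ n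
      (step a₀ a₁ w (B ω) (T ω) (J₀ ω) (J₁ ω)) s ∂P

lemma norm_exp_sub_exp_le {s : ℂ} (hs : 0 ≤ s.re) {w w' : ℝ} (hw : 0 ≤ w) (hw' : 0 ≤ w') :
    ‖Complex.exp (-s * (w : ℂ)) - Complex.exp (-s * (w' : ℂ))‖ ≤ ‖s‖ * |w - w'| := by
  have hd : ∀ y ∈ Set.Ici (0 : ℝ), HasDerivWithinAt (fun y : ℝ => Complex.exp (-s * (y : ℂ)))
      (Complex.exp (-s * (y : ℂ)) * (-s)) (Set.Ici 0) y := by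
    intro y _
    have h1 : HasDerivAt (fun y : ℝ => -s * (y : ℂ)) (-s) y := by
      simpa using (Complex.ofRealCLM.hasDerivAt (x := y)).const_mul (-s)
    exact h1.cexp.hasDerivWithinAt
  have := Convex.norm_image_sub_le_of_norm_hasDerivWithin_le (C := ‖s‖) hd (fun y hy => by
    rw [norm_mul, norm_neg]
    exact mul_le_of_le_one_left (norm_nonneg _) (norm_exp_neg_mul_le_one hs hy))
    (convex_Ici 0) (Set.mem_Ici.2 hw') (Set.mem_Ici.2 hw)
  simpa using this

namespace IsInput

variable {n : ℕ} {s : ℂ}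

lemma measurable_startTransform (h : IsInput P l₀ l₁ B T J₀ J₁) (n : ℕ) (s : ℂ) :
    Measurable (fun w => startTransform P a₀ a₁ B T J₀ J₁ n w s) := by
  induction n with
  | zero => simp only [startTransform]; fun_prop
  | succ n ih =>
    simp only [startTransform]
    have hf : Measurable (fun z : ℝ × Ω => startTransform P a₀ a₁ B T J₀ J₁ n
        (step a₀ a₁ z.1 (B z.2) (T z.2) (J₀ z.2) (J₁ z.2)) s) :=
      ih.comp (measurable_step.comp (measurable_fst.prodMk
        (h.measurable_input.comp measurable_snd)))
    exact hf.stronglyMeasurable.integral_prod_right'.measurable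

lemma norm_startTransform_le (n : ℕ) (hs : 0 ≤ s.re) {w : ℝ} (hw : 0 ≤ w) :
    ‖startTransform P a₀ a₁ B T J₀ J₁ n w s‖ ≤ 1 := by
  induction n generalizing w with
  | zero => exact norm_exp_neg_mul_le_one hs hw
  | succ n ih =>
    have := norm_integral_le_of_norm_le_const (μ := P)
      (f := fun ω => startTransform P a₀ a₁ B T J₀ J₁ n
        (step a₀ a₁ w (B ω) (T ω) (J₀ ω) (J₁ ω)) s)
      (ae_of_all _ fun ω => ih (step_nonneg _ _ _ _ _))
    simpa [startTransform] using this

lemma integrable_startTransform (h : IsInput P l₀ l₁ B T J₀ J₁) (n : ℕ) (w : ℝ)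
    (hs : 0 ≤ s.re) :
    Integrable (fun ω => startTransform P a₀ a₁ B T J₀ J₁ n
      (step a₀ a₁ w (B ω) (T ω) (J₀ ω) (J₁ ω)) s) P :=
  Integrable.of_bound ((h.measurable_startTransform n s).comp
    (h.measurable_step_input w)).aestronglyMeasurable 1
    (ae_of_all _ fun _ => norm_startTransform_le n hs (step_nonneg _ _ _ _ _))

/-- Synchronous coupling: both starting points receive the same input, so each step contracts their
distance by `max a₀ a₁`. -/
lemma norm_startTransform_sub_le (h : IsInput P l₀ l₁ B T J₀ J₁)
    (ha₀ : a₀ ∈ Set.Ioo (0 : ℝ) 1) (ha₁ : a₁ ∈ Set.Ioo (0 : ℝ) 1) (n : ℕ) (hs : 0 ≤ s.re)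
    {w w' : ℝ} (hw : 0 ≤ w) (hw' : 0 ≤ w') :
    ‖startTransform P a₀ a₁ B T J₀ J₁ n w s - startTransform P a₀ a₁ B T J₀ J₁ n w' s‖
      ≤ ‖s‖ * |w - w'| * max a₀ a₁ ^ n := by
  induction n generalizing w w' with
  | zero => simpa [startTransform] using norm_exp_sub_exp_le hs hw hw'
  | succ n ih =>
    have hm := max_mem_Ioo ha₀ ha₁
    simp only [startTransform]
    rw [← integral_sub (h.integrable_startTransform n w hs) (h.integrable_startTransform n w' hs)]
    have := norm_integral_le_of_norm_le_const (μ := P) (C := ‖s‖ * |w - w'| * max a₀ a₁ ^ (n + 1))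
      (f := fun ω => startTransform P a₀ a₁ B T J₀ J₁ n
        (step a₀ a₁ w (B ω) (T ω) (J₀ ω) (J₁ ω)) s - startTransform P a₀ a₁ B T J₀ J₁ n
        (step a₀ a₁ w' (B ω) (T ω) (J₀ ω) (J₁ ω)) s)
      (ae_of_all _ fun ω => by
        refine (ih (step_nonneg _ _ _ _ _) (step_nonneg _ _ _ _ _)).trans ?_
        have h1 := abs_step_sub_le ha₀ ha₁ w w' (B ω) (T ω) (J₀ ω) (J₁ ω)
        have h2 : 0 ≤ max a₀ a₁ ^ n := pow_nonneg hm.1.le n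
        calc _ ≤ ‖s‖ * (max a₀ a₁ * |w - w'|) * max a₀ a₁ ^ n := by gcongr
          _ = _ := by ring)
    simpa using this

/-- `startTransform` conditions on the first step, whereas `balance` describes the last one. The
induction averages the identity over the state after the first step. -/
lemma startTransform_succ (h : IsInput P l₀ l₁ B T J₀ J₁) (ha₀ : 0 < a₀) (ha₁ : 0 < a₁)
    (hl₀ : 0 < l₀) (hl₁ : 0 < l₁) (n : ℕ) {w : ℝ} (hw : 0 ≤ w) (hs : 0 ≤ s.re) :
    ((l₀ : ℂ) - s) * ((l₁ : ℂ) - s) * startTransform P a₀ a₁ B T J₀ J₁ (n + 1) w s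
      = balance a₀ a₁ l₀ l₁ (chi P B T) (psi P B T)
        (startTransform P a₀ a₁ B T J₀ J₁ n w) s := by
  induction n generalizing w with
  | zero => exact h.integral_exp_step ha₀ ha₁ hl₀ hl₁ hw hs
  | succ n ih =>
    rw [startTransform, ← integral_const_mul]
    refine Eq.trans (integral_congr_ae (ae_of_all _ fun ω => ih (step_nonneg _ _ _ _ _))) ?_
    exact integral_balance ha₀ ha₁ hl₀ hl₁ (fun x hx => h.integrable_startTransform n w hx) hs

/-- Supplies the solutions required by `homogeneous_system`. Working with `startTransform` needs
only one input, not an i.i.d. sequence on `Ω`, so it also covers the stationary case. -/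
lemma exists_isSolution (h : IsInput P l₀ l₁ B T J₀ J₁) (ha₀ : a₀ ∈ Set.Ioo (0 : ℝ) 1)
    (ha₁ : a₁ ∈ Set.Ioo (0 : ℝ) 1) (hl₀ : 0 < l₀) (hl₁ : 0 < l₁) (hr : ‖r‖ ≤ 1) (m : ℕ) :
    ∃ F : ℂ → ℂ, IsSolution a₀ a₁ l₀ l₁ (chi P B T) (psi P B T) r
        (fun x => Complex.exp (-x * m) - 1) F ∧
      F =O[𝓝[{x | 0 ≤ x.re}] 0] (fun x => x) := by
  have hm := max_mem_Ioo ha₀ ha₁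
  -- Subtracting the chain started at `0` makes the terms decay geometrically, with a bound
  -- proportional to `‖s‖`. This gives summability for `|r| = 1` and the `O(s)` estimate at once.
  set v : ℕ → ℂ → ℂ := fun n s => startTransform P a₀ a₁ B T J₀ J₁ n m s
    - startTransform P a₀ a₁ B T J₀ J₁ n 0 s with hv
  have hbound : ∀ n, ∀ s : ℂ, 0 ≤ s.re → ‖r ^ n * v n s‖ ≤ ‖s‖ * m * max a₀ a₁ ^ n := by
    intro n s hs
    have h1 := h.norm_startTransform_sub_le ha₀ ha₁ n hs (w := (m : ℝ)) (w' := 0)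
      (Nat.cast_nonneg m) le_rfl
    rw [sub_zero, abs_of_nonneg (Nat.cast_nonneg m)] at h1
    rw [norm_mul, norm_pow]
    exact (mul_le_of_le_one_left (norm_nonneg _) (pow_le_one₀ (norm_nonneg r) hr)).trans h1
  have hgeo := summable_geometric_of_lt_one hm.1.le hm.2
  refine ⟨fun s => ∑' n, r ^ n * v n s, ?_, ?_⟩
  · have h0 : v 0 = fun x => Complex.exp (-x * m) - 1 := by
      funext x
      simp [hv, startTransform]
    rw [← h0]
    refine isSolution_tsum ha₀.1 ha₁.1 hl₀ hl₁ (fun n s hs => ?_)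
      fun s hs => Summable.of_norm_bounded (hgeo.mul_left _) fun n => hbound n s hs
    have e1 := h.startTransform_succ ha₀.1 ha₁.1 hl₀ hl₁ n (w := (m : ℝ)) (Nat.cast_nonneg m) hs
    have e2 := h.startTransform_succ ha₀.1 ha₁.1 hl₀ hl₁ n (w := 0) le_rfl hs
    simp only [balance] at e1 e2
    simp only [hv, balance]
    linear_combination e1 - e2
  · refine Asymptotics.IsBigO.of_bound ((m : ℝ) * (1 - max a₀ a₁)⁻¹) ?_
    filter_upwards [self_mem_nhdsWithin] with s hs
    have := tsum_of_norm_bounded ((hasSum_geometric_of_lt_one hm.1.le hm.2).mul_left (‖s‖ * m))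
      fun n => hbound n s hs
    linarith

end IsInput

end Iteration

/-! ### The inhomogeneous linear system for the constants. -/

section LinearSystem

variable {Ω : Type*} [MeasurableSpace Ω] {P : Measure Ω} [IsProbabilityMeasure P]
  {a₀ a₁ l₀ l₁ : ℝ} {B T J₀ J₁ : Ω → ℝ} {r : ℂ}

/-- The linear system obtained by substituting an expression that depends on the constants through
the lattice-path series has at most one solution. -/
lemma IsInput.system_iff (h : IsInput P l₀ l₁ B T J₀ J₁)
    (ha₀ : a₀ ∈ Set.Ioo (0 : ℝ) 1) (ha₁ : a₁ ∈ Set.Ioo (0 : ℝ) 1) (hl₀ : 0 < l₀) (hl₁ : 0 < l₁)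
    (hr : ‖r‖ ≤ 1) (hl : l₀ ≠ l₁)
    (hreg₀ : Regular a₀ a₁ l₀ l₁ ((a₀ : ℂ) * (l₀ : ℂ)))
    (hreg₁ : Regular a₀ a₁ l₀ l₁ ((a₁ : ℂ) * (l₁ : ℂ)))
    {C₁ C₂ : ℂ} (G : ℂ → ℂ → ℂ → ℂ)
    (hG : ∀ s, Regular a₀ a₁ l₀ l₁ s → ∀ D₁ D₂ : ℂ, G D₁ D₂ s = G C₁ C₂ s
      + pathSeries a₀ a₁ (hFun l₀ (chi P B T)) (hFun l₁ (psi P B T)) r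
        (LFun l₀ l₁ (D₁ - C₁) (D₂ - C₂)) s)
    (hC₀ : -r * ((l₁ : ℂ) - (l₀ : ℂ)) * chi P B T (l₀ : ℂ) * G C₁ C₂ ((a₀ : ℂ) * (l₀ : ℂ))
      = C₁ + (l₀ : ℂ) * C₂)
    (hC₁ : -r * ((l₀ : ℂ) - (l₁ : ℂ)) * psi P B T (l₁ : ℂ) * G C₁ C₂ ((a₁ : ℂ) * (l₁ : ℂ))
      = C₁ + (l₁ : ℂ) * C₂) (D₁ D₂ : ℂ) :
    (-r * ((l₁ : ℂ) - (l₀ : ℂ)) * chi P B T (l₀ : ℂ) * G D₁ D₂ ((a₀ : ℂ) * (l₀ : ℂ))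
        = D₁ + (l₀ : ℂ) * D₂ ∧
      -r * ((l₀ : ℂ) - (l₁ : ℂ)) * psi P B T (l₁ : ℂ) * G D₁ D₂ ((a₁ : ℂ) * (l₁ : ℂ))
        = D₁ + (l₁ : ℂ) * D₂)
      ↔ (D₁ = C₁ ∧ D₂ = C₂) := by
  constructor
  · rintro ⟨e0, e1⟩
    rw [hG _ hreg₀] at e0
    rw [hG _ hreg₁] at e1
    -- `G` is affine in the constants, so the difference of two solutions solves the homogeneous
    -- system.
    have := h.subStochastic.homogeneous_system ha₀ ha₁ hl₀ hl₁ hr hl hreg₀ hreg₁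
      (h.exists_isSolution ha₀ ha₁ hl₀ hl₁ hr) (E₁ := D₁ - C₁) (E₂ := D₂ - C₂)
      (by linear_combination e0 - hC₀) (by linear_combination e1 - hC₁)
    exact ⟨sub_eq_zero.1 this.1, sub_eq_zero.1 this.2⟩
  · rintro ⟨rfl, rfl⟩
    exact ⟨hC₀, hC₁⟩

lemma pathSeries_LFun_add {χ ψ f : ℂ → ℂ} {s : ℂ} (hχψ : SubStochastic χ ψ)
    (ha₀ : a₀ ∈ Set.Ioo (0 : ℝ) 1) (ha₁ : a₁ ∈ Set.Ioo (0 : ℝ) 1) (hl₀ : 0 < l₀) (hl₁ : 0 < l₁)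
    (hr : ‖r‖ ≤ 1) (hs : 0 ≤ s.re) {C₁ C₂ : ℂ}
    (hsum : Summable (fun i => r ^ i * pathSum a₀ a₁ (hFun l₀ χ) (hFun l₁ ψ)
      (fun x => LFun l₀ l₁ C₁ C₂ x + f x) i s)) (D₁ D₂ : ℂ) :
    pathSeries a₀ a₁ (hFun l₀ χ) (hFun l₁ ψ) r (fun x => LFun l₀ l₁ D₁ D₂ x + f x) s
      = pathSeries a₀ a₁ (hFun l₀ χ) (hFun l₁ ψ) r (fun x => LFun l₀ l₁ C₁ C₂ x + f x) s
        + pathSeries a₀ a₁ (hFun l₀ χ) (hFun l₁ ψ) r (LFun l₀ l₁ (D₁ - C₁) (D₂ - C₂)) s := by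
  rw [← pathSeries_add hsum (hχψ.summable_pathSum_of_isBigO_id ha₀ ha₁ hl₀ hl₁ hs
    (LFun_isBigO hl₀ hl₁ _ _ _) hr)]
  congr 1
  funext x
  have := congrFun (LFun_add (l₀ := l₀) (l₁ := l₁) C₁ C₂ (D₁ - C₁) (D₂ - C₂)) x
  simp only [add_sub_cancel] at this
  rw [this]
  ring

end LinearSystem

/-! ### Waiting times driven by an i.i.d. input sequence. -/

section Transient

variable {Ω : Type*} [MeasurableSpace Ω] {P : Measure Ω} {a₀ a₁ l₀ l₁ w : ℝ}
  {B T J₀ J₁ : ℕ → Ω → ℝ}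

lemma waiting_nonneg {Ω : Type*} {B T J₀ J₁ : ℕ → Ω → ℝ} (hw : 0 ≤ w)
    (n : ℕ) (ω : Ω) : 0 ≤ waiting a₀ a₁ w B T J₀ J₁ n ω := by
  cases n with
  | zero => exact hw
  | succ n => exact step_nonneg _ _ _ _ _

namespace IsInputSequence

/-- With numbering from `0`, the `n`-th waiting time uses only inputs of index below `n`; its
independence of input `n` follows. -/
lemma measurable_waiting_past {Ω : Type*} {B T J₀ J₁ : ℕ → Ω → ℝ} (n : ℕ) :
    Measurable[⨆ i ∈ Set.Iio n, MeasurableSpace.comap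
      (fun ω => (B i ω, T i ω, J₀ i ω, J₁ i ω)) inferInstance] (waiting a₀ a₁ w B T J₀ J₁ n) := by
  induction n with
  | zero => exact measurable_const
  | succ n ih =>
    have h1 : Measurable[⨆ i ∈ Set.Iio (n + 1), MeasurableSpace.comap
        (fun ω => (B i ω, T i ω, J₀ i ω, J₁ i ω)) inferInstance]
        (waiting a₀ a₁ w B T J₀ J₁ n) :=
      ih.mono (biSup_mono fun i hi => Set.mem_Iio.2 (Nat.lt_succ_of_lt hi)) le_rfl
    have h2 : Measurable[⨆ i ∈ Set.Iio (n + 1), MeasurableSpace.comap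
        (fun ω => (B i ω, T i ω, J₀ i ω, J₁ i ω)) inferInstance]
        (fun ω => (B n ω, T n ω, J₀ n ω, J₁ n ω)) :=
      (comap_measurable _).mono (le_biSup (fun i => MeasurableSpace.comap
        (fun ω => (B i ω, T i ω, J₀ i ω, J₁ i ω)) inferInstance)
        (Set.mem_Iio.2 (Nat.lt_succ_self n))) le_rfl
    exact measurable_step.comp (h1.prodMk h2)

lemma comap_le (h : IsInputSequence P l₀ l₁ B T J₀ J₁) (i : ℕ) :
    MeasurableSpace.comap (fun ω => (B i ω, T i ω, J₀ i ω, J₁ i ω)) inferInstance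
      ≤ (inferInstance : MeasurableSpace Ω) :=
  (h.input i).measurable_input.comap_le

lemma measurable_waiting (h : IsInputSequence P l₀ l₁ B T J₀ J₁) (n : ℕ) :
    Measurable (waiting a₀ a₁ w B T J₀ J₁ n) :=
  (measurable_waiting_past n).mono (iSup₂_le fun i _ => h.comap_le i) le_rfl

/-- A waiting time is independent of the input of the next step. -/
lemma indepFun_waiting (h : IsInputSequence P l₀ l₁ B T J₀ J₁) (n : ℕ) :
    IndepFun (waiting a₀ a₁ w B T J₀ J₁ n) (fun ω => (B n ω, T n ω, J₀ n ω, J₁ n ω)) P := by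
  have hi := indep_iSup_of_disjoint h.comap_le h.indep.iIndep
    (S := Set.Iio n) (T := {n}) (by simp)
  rw [iSup_singleton] at hi
  rw [IndepFun_iff_Indep]
  exact indep_of_indep_of_le_left hi (measurable_waiting_past n).comap_le

lemma chi_eq (h : IsInputSequence P l₀ l₁ B T J₀ J₁) (n : ℕ) :
    chi P (B n) (T n) = chi P (B 0) (T 0) := by
  have e : ∀ n s, chi P (B n) (T n) s = ∫ q in {q : ℝ × ℝ | q.1 < q.2},
      Complex.exp (-s * (q.1 : ℂ)) ∂(P.map (fun ω => (B n ω, T n ω))) := by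
    intro n s
    rw [setIntegral_map (measurableSet_lt measurable_fst measurable_snd)
      (Measurable.aestronglyMeasurable (by fun_prop))
      ((h.input n).measurable_B.prodMk (h.input n).measurable_T).aemeasurable]
    rfl
  have hid := ((h.ident n).comp (u := fun q : ℝ × ℝ × ℝ × ℝ => (q.1, q.2.1)) (by fun_prop)).map_eq
  funext s
  rw [e n, e 0]
  simp only [Function.comp_def] at hid
  rw [hid]

lemma psi_eq (h : IsInputSequence P l₀ l₁ B T J₀ J₁) (n : ℕ) :
    psi P (B n) (T n) = psi P (B 0) (T 0) := by
  have e : ∀ n s, psi P (B n) (T n) s = ∫ q in {q : ℝ × ℝ | q.2 ≤ q.1},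
      Complex.exp (-s * (q.2 : ℂ)) ∂(P.map (fun ω => (B n ω, T n ω))) := by
    intro n s
    rw [setIntegral_map (measurableSet_le measurable_snd measurable_fst)
      (Measurable.aestronglyMeasurable (by fun_prop))
      ((h.input n).measurable_B.prodMk (h.input n).measurable_T).aemeasurable]
    rfl
  have hid := ((h.ident n).comp (u := fun q : ℝ × ℝ × ℝ × ℝ => (q.1, q.2.1)) (by fun_prop)).map_eq
  funext s
  rw [e n, e 0]
  simp only [Function.comp_def] at hid
  rw [hid]

variable [IsProbabilityMeasure P] {r : ℂ}

lemma norm_pow_mul_lst_le (hw : 0 ≤ w) (n : ℕ) {s : ℂ} (hs : 0 ≤ s.re) :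
    ‖r ^ (n + 1) * lst P (waiting a₀ a₁ w B T J₀ J₁ n) s‖ ≤ ‖r‖ ^ (n + 1) := by
  rw [norm_mul, norm_pow]
  exact mul_le_of_le_one_right (by positivity)
    (norm_lst_le_one (ae_of_all _ (waiting_nonneg hw n)) hs)

lemma isSolution (h : IsInputSequence P l₀ l₁ B T J₀ J₁) (ha₀ : 0 < a₀) (ha₁ : 0 < a₁)
    (hl₀ : 0 < l₀) (hl₁ : 0 < l₁) (hw : 0 ≤ w) (hr : ‖r‖ < 1) :
    IsSolution a₀ a₁ l₀ l₁ (chi P (B 0) (T 0)) (psi P (B 0) (T 0)) r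
      (fun s => r * Complex.exp (-s * (w : ℂ)))
      (fun s => genFun r (fun n => lst P (waiting a₀ a₁ w B T J₀ J₁ n) s)) := by
  have hgeo : Summable (fun n : ℕ => ‖r‖ ^ (n + 1)) :=
    (summable_nat_add_iff 1).2 (summable_geometric_of_lt_one (norm_nonneg r) hr)
  have e : ∀ n s, r ^ (n + 1) * lst P (waiting a₀ a₁ w B T J₀ J₁ n) s
      = r ^ n * (r * lst P (waiting a₀ a₁ w B T J₀ J₁ n) s) := fun n s => by ring
  have hsol := isSolution_tsum (χ := chi P (B 0) (T 0)) (ψ := psi P (B 0) (T 0)) (r := r)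
    ha₀ ha₁ hl₀ hl₁
    -- The extra factor `r` matches `genFun`, whose powers start at `r¹`, and makes the
    -- inhomogeneity `r e^{-sw}`.
    (v := fun n s => r * lst P (waiting a₀ a₁ w B T J₀ J₁ n) s) (fun n s hs => by
      have := (h.input n).lst_step ha₀ ha₁ hl₀ hl₁ (h.measurable_waiting n)
        (ae_of_all _ (waiting_nonneg hw n)) (h.indepFun_waiting (a₀ := a₀) (a₁ := a₁) (w := w) n) hs
      rw [h.chi_eq, h.psi_eq] at this
      have e2 : waiting a₀ a₁ w B T J₀ J₁ (n + 1) = fun ω => step a₀ a₁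
        (waiting a₀ a₁ w B T J₀ J₁ n ω) (B n ω) (T n ω) (J₀ n ω) (J₁ n ω) := rfl
      rw [e2]
      simp only [balance] at this ⊢
      linear_combination r * this)
    (fun s hs => (Summable.of_norm_bounded hgeo fun n => norm_pow_mul_lst_le hw n hs).congr
      fun n => e n s)
  have h0 : (fun s => r * lst P (waiting a₀ a₁ w B T J₀ J₁ 0) s)
      = fun s => r * Complex.exp (-s * (w : ℂ)) := by
    funext s
    simp [lst, waiting]
  simp only [h0] at hsol
  simpa only [genFun, e] using hsol

end IsInputSequence

end Transient

end ThresholdAR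

end

/-! ### The main theorem: transient case, stationary case, equal coefficients. -/

open ThresholdAR

theorem mainTheorem4 {Ω : Type*} [MeasurableSpace Ω] (P : MeasureTheory.Measure Ω)
    [MeasureTheory.IsProbabilityMeasure P]
    (a₀ a₁ l₀ l₁ : ℝ) (ha₀ : a₀ ∈ Set.Ioo (0 : ℝ) 1) (ha₁ : a₁ ∈ Set.Ioo (0 : ℝ) 1)
    (hl₀ : 0 < l₀) (hl₁ : 0 < l₁) :
    -- transient behaviour
    (∀ (B T J₀ J₁ : ℕ → Ω → ℝ), ThresholdAR.IsInputSequence P l₀ l₁ B T J₀ J₁ →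
      ∀ (w : ℝ), 0 ≤ w → ∀ (r : ℂ), ‖r‖ < 1 →
      let χ : ℂ → ℂ := ThresholdAR.chi P (B 0) (T 0)
      let ψ : ℂ → ℂ := ThresholdAR.psi P (B 0) (T 0)
      let h₀ : ℂ → ℂ := ThresholdAR.hFun l₀ χ
      let h₁ : ℂ → ℂ := ThresholdAR.hFun l₁ ψ
      let W : ℕ → Ω → ℝ := ThresholdAR.waiting a₀ a₁ w B T J₀ J₁
      let U : ℕ → ℂ → ℂ := fun n =>
        ThresholdAR.negTransform P a₀ a₁ (W n) (B n) (T n) (J₀ n) (J₁ n)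
      let Z : ℂ → ℂ := fun s => ThresholdAR.genFun r (fun n => ThresholdAR.lst P (W n) s)
      let M : ℂ → ℂ := fun s => ThresholdAR.genFun r (fun n => U n s)
      let L : ℂ → ℂ → ℂ → ℂ := fun D₁ D₂ s =>
        ThresholdAR.LFun l₀ l₁ D₁ D₂ s + r * Complex.exp (-s * (w : ℂ))
      let S : ℂ → ℂ → ℂ → ℂ := fun D₁ D₂ s =>
        ∑' i : ℕ, r ^ i * ThresholdAR.pathSum a₀ a₁ h₀ h₁ (L D₁ D₂) i s
      ContinuousOn Z {s | 0 ≤ s.re} ∧ DifferentiableOn ℂ Z {s | 0 < s.re} ∧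
      (∀ s : ℂ, 0 ≤ s.re → Summable (fun n : ℕ => r ^ (n + 1) * ThresholdAR.lst P (W n) s)) ∧
      (∀ s : ℂ, s.re ≤ 0 → Summable (fun n : ℕ => r ^ (n + 1) * U n s)) ∧
      ∃ C₁ C₂ : ℂ,
        (∀ s : ℂ, 0 ≤ s.re →
          ((l₀ : ℂ) - s) * ((l₁ : ℂ) - s) * (Z s - r * Complex.exp (-s * (w : ℂ)))
            - r * ((l₀ : ℂ) * ((l₁ : ℂ) - s) * χ s * Z ((a₀ : ℂ) * s)
              + (l₁ : ℂ) * ((l₀ : ℂ) - s) * ψ s * Z ((a₁ : ℂ) * s))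
          = s * C₁ + s ^ 2 * C₂) ∧
        (∀ s : ℂ, s.re ≤ 0 →
          ((l₀ : ℂ) - s) * ((l₁ : ℂ) - s) * (r ^ 2 / (1 - r) - r * M s)
          = s * C₁ + s ^ 2 * C₂) ∧
        -r * ((l₁ : ℂ) - (l₀ : ℂ)) * χ (l₀ : ℂ) * Z ((a₀ : ℂ) * (l₀ : ℂ))
          = C₁ + (l₀ : ℂ) * C₂ ∧
        -r * ((l₀ : ℂ) - (l₁ : ℂ)) * ψ (l₁ : ℂ) * Z ((a₁ : ℂ) * (l₁ : ℂ))
          = C₁ + (l₁ : ℂ) * C₂ ∧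
        -- the lattice-path series
        (∀ s : ℂ, ThresholdAR.Regular a₀ a₁ l₀ l₁ s →
          (∀ D₁ D₂ : ℂ, Summable
            (fun i : ℕ => r ^ i * ThresholdAR.pathSum a₀ a₁ h₀ h₁ (L D₁ D₂) i s)) ∧
          Z s = S C₁ C₂ s) ∧
        -- the linear system for the constants
        (l₀ ≠ l₁ → ThresholdAR.Regular a₀ a₁ l₀ l₁ ((a₀ : ℂ) * (l₀ : ℂ)) →
          ThresholdAR.Regular a₀ a₁ l₀ l₁ ((a₁ : ℂ) * (l₁ : ℂ)) →
          ∀ D₁ D₂ : ℂ,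
            (-r * ((l₁ : ℂ) - (l₀ : ℂ)) * χ (l₀ : ℂ) * S D₁ D₂ ((a₀ : ℂ) * (l₀ : ℂ))
                = D₁ + (l₀ : ℂ) * D₂ ∧
              -r * ((l₀ : ℂ) - (l₁ : ℂ)) * ψ (l₁ : ℂ) * S D₁ D₂ ((a₁ : ℂ) * (l₁ : ℂ))
                = D₁ + (l₁ : ℂ) * D₂)
            ↔ (D₁ = C₁ ∧ D₂ = C₂))) ∧
    -- stationary behaviour
    (∀ (W B T J₀ J₁ : Ω → ℝ), ThresholdAR.IsInput P l₀ l₁ B T J₀ J₁ →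
      ThresholdAR.IsStationary P a₀ a₁ W B T J₀ J₁ →
      let χ : ℂ → ℂ := ThresholdAR.chi P B T
      let ψ : ℂ → ℂ := ThresholdAR.psi P B T
      let h₀ : ℂ → ℂ := ThresholdAR.hFun l₀ χ
      let h₁ : ℂ → ℂ := ThresholdAR.hFun l₁ ψ
      let H : ℂ → ℂ := fun s => h₀ s + h₁ s
      let Z : ℂ → ℂ := ThresholdAR.lst P W
      let M : ℂ → ℂ := ThresholdAR.negTransform P a₀ a₁ W B T J₀ J₁
      let L : ℂ → ℂ → ℂ → ℂ := ThresholdAR.LFun l₀ l₁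
      let S : ℂ → ℂ → ℂ → ℂ := fun D₁ D₂ s =>
        ∑' i : ℕ, ThresholdAR.pathSum a₀ a₁ h₀ h₁ (L D₁ D₂) i s
      ContinuousOn Z {s | 0 ≤ s.re} ∧ DifferentiableOn ℂ Z {s | 0 < s.re} ∧
      ∃ (C₁ C₂ : ℂ) (ℓ : ℂ → ℂ),
        (∀ s : ℂ, 0 ≤ s.re →
          ((l₀ : ℂ) - s) * ((l₁ : ℂ) - s) * Z s
            - ((l₀ : ℂ) * ((l₁ : ℂ) - s) * χ s * Z ((a₀ : ℂ) * s)
              + (l₁ : ℂ) * ((l₀ : ℂ) - s) * ψ s * Z ((a₁ : ℂ) * s))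
          = s * C₁ + s ^ 2 * C₂) ∧
        (∀ s : ℂ, s.re ≤ 0 →
          ((l₀ : ℂ) - s) * ((l₁ : ℂ) - s) * (1 - M s) = s * C₁ + s ^ 2 * C₂) ∧
        -((l₁ : ℂ) - (l₀ : ℂ)) * χ (l₀ : ℂ) * Z ((a₀ : ℂ) * (l₀ : ℂ))
          = C₁ + (l₀ : ℂ) * C₂ ∧
        -((l₀ : ℂ) - (l₁ : ℂ)) * ψ (l₁ : ℂ) * Z ((a₁ : ℂ) * (l₁ : ℂ))
          = C₁ + (l₁ : ℂ) * C₂ ∧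
        -- the lattice-path formula; `ℓ s` is the limit of the sums of the weights
        (∀ s : ℂ, ThresholdAR.Regular a₀ a₁ l₀ l₁ s →
          Filter.Tendsto (fun n : ℕ => ThresholdAR.pathSum a₀ a₁ h₀ h₁ (fun _ => 1) n s)
            Filter.atTop (nhds (ℓ s)) ∧
          (∀ D₁ D₂ : ℂ, Summable
            (fun i : ℕ => ThresholdAR.pathSum a₀ a₁ h₀ h₁ (L D₁ D₂) i s)) ∧
          Z s = ℓ s + S C₁ C₂ s) ∧
        -- the linear system for the constants
        (l₀ ≠ l₁ → ThresholdAR.Regular a₀ a₁ l₀ l₁ ((a₀ : ℂ) * (l₀ : ℂ)) →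
          ThresholdAR.Regular a₀ a₁ l₀ l₁ ((a₁ : ℂ) * (l₁ : ℂ)) →
          ∀ D₁ D₂ : ℂ,
            (-((l₁ : ℂ) - (l₀ : ℂ)) * χ (l₀ : ℂ)
                  * (ℓ ((a₀ : ℂ) * (l₀ : ℂ)) + S D₁ D₂ ((a₀ : ℂ) * (l₀ : ℂ)))
                = D₁ + (l₀ : ℂ) * D₂ ∧
              -((l₀ : ℂ) - (l₁ : ℂ)) * ψ (l₁ : ℂ)
                  * (ℓ ((a₁ : ℂ) * (l₁ : ℂ)) + S D₁ D₂ ((a₁ : ℂ) * (l₁ : ℂ)))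
                = D₁ + (l₁ : ℂ) * D₂)
            ↔ (D₁ = C₁ ∧ D₂ = C₂)) ∧
        -- the case of equal autoregression coefficients
        (∀ a : ℝ, a₀ = a → a₁ = a →
          let Q : ℂ → ℕ → ℂ := fun s n => ∏ j ∈ Finset.range n, H ((a : ℂ) ^ j * s)
          let R : ℂ → ℂ → ℂ → ℂ := fun D₁ D₂ s =>
            ∑' n : ℕ, L D₁ D₂ ((a : ℂ) ^ n * s) * Q s n
          (∀ s : ℂ, ThresholdAR.Regular a a l₀ l₁ s →
            Filter.Tendsto (Q s) Filter.atTop (nhds (ℓ s)) ∧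
            (∀ D₁ D₂ : ℂ, Summable (fun n : ℕ => L D₁ D₂ ((a : ℂ) ^ n * s) * Q s n)) ∧
            Z s = ℓ s + R C₁ C₂ s) ∧
          (l₀ ≠ l₁ → ThresholdAR.Regular a a l₀ l₁ ((a : ℂ) * (l₀ : ℂ)) →
            ThresholdAR.Regular a a l₀ l₁ ((a : ℂ) * (l₁ : ℂ)) →
            ∀ D₁ D₂ : ℂ,
              (-((l₁ : ℂ) - (l₀ : ℂ)) * χ (l₀ : ℂ)
                    * (ℓ ((a : ℂ) * (l₀ : ℂ)) + R D₁ D₂ ((a : ℂ) * (l₀ : ℂ)))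
                  = D₁ + (l₀ : ℂ) * D₂ ∧
                -((l₀ : ℂ) - (l₁ : ℂ)) * ψ (l₁ : ℂ)
                    * (ℓ ((a : ℂ) * (l₁ : ℂ)) + R D₁ D₂ ((a : ℂ) * (l₁ : ℂ)))
                  = D₁ + (l₁ : ℂ) * D₂)
              ↔ (D₁ = C₁ ∧ D₂ = C₂)))) := by
  refine ⟨?_, ?_⟩
  · intro B T J₀ J₁ hin w hw r hr χ ψ h₀ h₁ W U Z M L S
    have hsub : SubStochastic χ ψ := (hin.input 0).subStochastic
    have hgeo : Summable (fun n : ℕ => ‖r‖ ^ (n + 1)) :=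
      (summable_nat_add_iff 1).2 (summable_geometric_of_lt_one (norm_nonneg r) hr)
    have hW0 : ∀ n, ∀ᵐ ω ∂P, 0 ≤ W n ω := fun n => ae_of_all _ (waiting_nonneg hw n)
    have hWm : ∀ n, Measurable (W n) := fun n => hin.measurable_waiting n
    have hb : ∀ n, ∀ s : ℂ, 0 ≤ s.re → ‖r ^ (n + 1) * lst P (W n) s‖ ≤ ‖r‖ ^ (n + 1) :=
      fun n s hs => IsInputSequence.norm_pow_mul_lst_le hw n hs
    have hsumZ : ∀ s : ℂ, 0 ≤ s.re → Summable (fun n : ℕ => r ^ (n + 1) * lst P (W n) s) :=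
      fun s hs => Summable.of_norm_bounded hgeo fun n => hb n s hs
    have hsumM : ∀ s : ℂ, s.re ≤ 0 → Summable (fun n : ℕ => r ^ (n + 1) * U n s) := by
      intro s hs
      refine Summable.of_norm_bounded hgeo fun n => ?_
      rw [norm_mul, norm_pow]
      exact mul_le_of_le_one_right (by positivity)
        ((hin.input n).norm_negTransform_le_one (hWm n) hs)
    have hsol : IsSolution a₀ a₁ l₀ l₁ χ ψ r (fun s => r * Complex.exp (-s * (w : ℂ))) Z :=
      hin.isSolution ha₀.1 ha₁.1 hl₀ hl₁ hw hr
    -- Only boundedness is available, since `r e^{-sw}` need not vanish at `0`; `|r| < 1` makes up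
    -- for it.
    have hLO : ∀ D₁ D₂ : ℂ, L D₁ D₂ =O[𝓝[{x | 0 ≤ x.re}] 0] (fun _ => (1 : ℂ)) := by
      intro D₁ D₂
      refine ((LFun_isBigO hl₀ hl₁ D₁ D₂ _).trans ?_).add ?_
      · exact (continuous_id.continuousWithinAt (x := (0 : ℂ))).tendsto.isBigO_one ℂ
      · exact (Continuous.continuousWithinAt (f := fun s : ℂ => r * Complex.exp (-s * (w : ℂ)))
          (by fun_prop) (x := (0 : ℂ))).tendsto.isBigO_one ℂ
    have hsumS : ∀ s, Regular a₀ a₁ l₀ l₁ s → ∀ D₁ D₂ : ℂ,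
        Summable (fun i : ℕ => r ^ i * pathSum a₀ a₁ h₀ h₁ (L D₁ D₂) i s) :=
      fun s hs D₁ D₂ =>
        hsub.summable_pathSum_of_isBigO_one ha₀ ha₁ hl₀ hl₁ hs.1 (hLO D₁ D₂) hr
    have hcont : ContinuousOn Z {s | 0 ≤ s.re} :=
      continuousOn_tsum (fun n => (continuousOn_lst (hWm n) (hW0 n)).const_mul _) hgeo hb
    have hZS : ∀ s, Regular a₀ a₁ l₀ l₁ s →
        Z s = S (const₁ a₀ a₁ l₀ l₁ χ ψ r Z) (const₂ a₀ a₁ l₀ l₁ χ ψ r Z) s := by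
      intro s hs
      refine hsol.eq_pathSeries ha₀ ha₁ hs (hsumS s hs _ _) ?_
      refine hsub.tendsto_pow_mul_pathSum ha₀ ha₁ hl₀ hl₁ hs.1 ?_ hr
      exact (hcont 0 (by simp)).tendsto.isBigO_one ℂ
    have hc₀ := const_at_l₀ (a₀ := a₀) (a₁ := a₁) (l₀ := l₀) (l₁ := l₁) (χ := χ) (ψ := ψ)
      (r := r) (F := Z)
    have hc₁ := const_at_l₁ (a₀ := a₀) (a₁ := a₁) (l₀ := l₀) (l₁ := l₁) (χ := χ) (ψ := ψ)
      (r := r) (F := Z)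
    refine ⟨hcont, ?_, hsumZ, hsumM, const₁ a₀ a₁ l₀ l₁ χ ψ r Z, const₂ a₀ a₁ l₀ l₁ χ ψ r Z,
      ?_, ?_, hc₀, hc₁, fun s hs => ⟨hsumS s hs, hZS s hs⟩, ?_⟩
    · exact Complex.differentiableOn_tsum_of_summable_norm hgeo
        (fun n => (differentiableOn_lst (hWm n) (hW0 n)).const_mul _)
        (isOpen_lt continuous_const Complex.continuous_re) fun n s hs => hb n s (le_of_lt hs)
    · intro s hs
      have e := hsol s hs
      rw [mul_balance_eq] at e
      linear_combination e
    · intro s hs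
      have k₀ := (hsumZ _ (ofReal_mul_re_nonneg (s := (l₀ : ℂ)) ha₀.1
        (by simpa using hl₀.le))).hasSum
      have k₁ := (hsumZ _ (ofReal_mul_re_nonneg (s := (l₁ : ℂ)) ha₁.1
        (by simpa using hl₁.le))).hasSum
      -- Summing `rⁿ⁺¹(1 - U n)` gives `r/(1 - r) - M`. One more factor `r` yields `r²/(1 - r) - rM`
      -- and matches the factor `r` in the constants.
      have g : HasSum (fun n : ℕ => r ^ (n + 1)) (r * (1 - r)⁻¹) :=
        ((hasSum_geometric_of_norm_lt_one hr).mul_left r).congr_fun fun n => pow_succ' r n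
      have s1 := (g.sub (hsumM s hs).hasSum).mul_left (((l₀ : ℂ) - s) * ((l₁ : ℂ) - s))
      have s2 := ((k₀.mul_left (-s * ((l₁ : ℂ) - s) * χ l₀)).sub
        (k₁.mul_left (s * ((l₀ : ℂ) - s) * ψ l₁)))
      have e := s1.unique (s2.congr_fun fun n => by
        have := (hin.input n).negTransform_eq ha₀.1 ha₁.1 hl₀ hl₁ (hWm n) (hW0 n)
          (hin.indepFun_waiting n) hs
        rw [hin.chi_eq, hin.psi_eq] at this
        simp only [const₁, const₂] at this
        linear_combination r ^ (n + 1) * this)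
      have hM : M s = ∑' n : ℕ, r ^ (n + 1) * U n s := rfl
      have hZ₀ : Z ((a₀ : ℂ) * l₀) = ∑' n : ℕ, r ^ (n + 1) * lst P (W n) ((a₀ : ℂ) * l₀) := rfl
      have hZ₁ : Z ((a₁ : ℂ) * l₁) = ∑' n : ℕ, r ^ (n + 1) * lst P (W n) ((a₁ : ℂ) * l₁) := rfl
      rw [← hM, ← hZ₀, ← hZ₁] at e
      have hr2 : r ^ 2 / (1 - r) = r * (r * (1 - r)⁻¹) := by ring
      rw [hr2]
      simp only [const₁, const₂]
      linear_combination r * e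
    · intro hl hreg₀ hreg₁
      refine (hin.input 0).system_iff ha₀ ha₁ hl₀ hl₁ hr.le hl hreg₀ hreg₁ S
        (fun s hs D₁ D₂ => pathSeries_LFun_add hsub ha₀ ha₁ hl₀ hl₁ hr.le hs.1
          (hsumS s hs _ _) D₁ D₂) ?_ ?_
      · rw [← hZS _ hreg₀]
        exact hc₀
      · rw [← hZS _ hreg₁]
        exact hc₁
  · intro W B T J₀ J₁ hin hst χ ψ h₀ h₁ H Z M L S
    have hsub : SubStochastic χ ψ := hin.subStochastic
    have hWm := hst.measurable_W
    -- Nonnegativity is not assumed: `W` has the law of a positive part.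
    have hW0 : ∀ᵐ ω ∂P, 0 ≤ W ω :=
      hst.ident.ae_snd measurableSet_Ici (ae_of_all _ fun _ => step_nonneg _ _ _ _ _)
    have hlst : lst P (fun ω => step a₀ a₁ (W ω) (B ω) (T ω) (J₀ ω) (J₁ ω)) = Z := by
      funext s
      exact (hst.ident.comp (u := fun y : ℝ => Complex.exp (-s * (y : ℂ)))
        (by fun_prop)).integral_eq
    have hsol : IsSolution a₀ a₁ l₀ l₁ χ ψ 1 (fun _ => 0) Z := by
      intro s hs
      have := hin.lst_step ha₀.1 ha₁.1 hl₀ hl₁ hWm hW0 hst.indep hs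
      rw [hlst] at this
      rw [sub_zero, one_mul, this]
    set C₁ := const₁ a₀ a₁ l₀ l₁ χ ψ 1 Z with hC₁
    set C₂ := const₂ a₀ a₁ l₀ l₁ χ ψ 1 Z with hC₂
    have hone : ‖(1 : ℂ)‖ ≤ 1 := by simp
    have hS : ∀ D₁ D₂ s, S D₁ D₂ s = pathSeries a₀ a₁ h₀ h₁ 1 (fun x => L D₁ D₂ x + 0) s := by
      intro D₁ D₂ s
      simp [S, pathSeries]
    have hsum1 : ∀ s, Regular a₀ a₁ l₀ l₁ s → ∀ D₁ D₂ : ℂ,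
        Summable (fun i : ℕ => 1 ^ i * pathSum a₀ a₁ h₀ h₁ (fun x => L D₁ D₂ x + 0) i s) := by
      intro s hs D₁ D₂
      simp only [add_zero]
      exact hsub.summable_pathSum_of_isBigO_id ha₀ ha₁ hl₀ hl₁ hs.1
        (LFun_isBigO hl₀ hl₁ D₁ D₂ _) hone
    have hsumS : ∀ s, Regular a₀ a₁ l₀ l₁ s → ∀ D₁ D₂ : ℂ,
        Summable (fun i : ℕ => pathSum a₀ a₁ h₀ h₁ (L D₁ D₂) i s) := by
      intro s hs D₁ D₂
      simpa using hsum1 s hs D₁ D₂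
    have hcont : ContinuousOn Z {s | 0 ≤ s.re} := continuousOn_lst hWm hW0
    have hZ0 : Z 0 = 1 := by simp [Z, lst]
    have hlim : ∀ s, Regular a₀ a₁ l₀ l₁ s →
        Tendsto (fun n : ℕ => pathSum a₀ a₁ h₀ h₁ (fun _ => 1) n s) atTop
          (𝓝 (Z s - S C₁ C₂ s)) := by
      intro s hs
      have t1 := hsol.tendsto_pow_mul_pathSum ha₀ ha₁ hs (hsum1 s hs C₁ C₂)
      rw [← hC₁, ← hC₂, ← hS] at t1
      simp only [one_pow, one_mul] at t1
      -- `1 - Z` tends to `0` at the origin, so the sums of the weights have the same limit as the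
      -- remainders `pathSum Z n`, which converge by `t1`.
      have t2 := hsub.tendsto_pathSum_zero (f := fun x => 1 + (-1) * Z x) ha₀ ha₁ hl₀ hl₁ hs.1 (by
        have := (hcont 0 (by simp)).tendsto.const_mul (-1) |>.const_add 1
        simpa [hZ0] using this)
      have t3 := t2.add t1
      rw [zero_add] at t3
      refine t3.congr fun n => ?_
      rw [pathSum_add, pathSum_const_mul]
      ring
    have hc₀ := const_at_l₀ (a₀ := a₀) (a₁ := a₁) (l₀ := l₀) (l₁ := l₁) (χ := χ) (ψ := ψ)
      (r := 1) (F := Z)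
    have hc₁ := const_at_l₁ (a₀ := a₀) (a₁ := a₁) (l₀ := l₀) (l₁ := l₁) (χ := χ) (ψ := ψ)
      (r := 1) (F := Z)
    rw [neg_one_mul, ← hC₁, ← hC₂] at hc₀ hc₁
    have hsys : l₀ ≠ l₁ → Regular a₀ a₁ l₀ l₁ ((a₀ : ℂ) * (l₀ : ℂ)) →
        Regular a₀ a₁ l₀ l₁ ((a₁ : ℂ) * (l₁ : ℂ)) → ∀ D₁ D₂ : ℂ,
        (-((l₁ : ℂ) - (l₀ : ℂ)) * χ (l₀ : ℂ)
              * (Z ((a₀ : ℂ) * (l₀ : ℂ)) - S C₁ C₂ ((a₀ : ℂ) * (l₀ : ℂ))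
                + S D₁ D₂ ((a₀ : ℂ) * (l₀ : ℂ)))
            = D₁ + (l₀ : ℂ) * D₂ ∧
          -((l₀ : ℂ) - (l₁ : ℂ)) * ψ (l₁ : ℂ)
              * (Z ((a₁ : ℂ) * (l₁ : ℂ)) - S C₁ C₂ ((a₁ : ℂ) * (l₁ : ℂ))
                + S D₁ D₂ ((a₁ : ℂ) * (l₁ : ℂ)))
            = D₁ + (l₁ : ℂ) * D₂)
          ↔ (D₁ = C₁ ∧ D₂ = C₂) := by
      intro hl hreg₀ hreg₁ D₁ D₂
      have := hin.system_iff (r := 1) ha₀ ha₁ hl₀ hl₁ hone hl hreg₀ hreg₁ (C₁ := C₁) (C₂ := C₂)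
        (fun D₁ D₂ s => Z s - S C₁ C₂ s + S D₁ D₂ s) (fun s hs D₁ D₂ => by
          have := pathSeries_LFun_add (f := fun _ => 0) hsub ha₀ ha₁ hl₀ hl₁ hone hs.1
            (hsum1 s hs C₁ C₂) D₁ D₂
          rw [hS D₁ D₂, this, ← hS C₁ C₂]
          ring) (by rw [sub_add_cancel, neg_one_mul]; exact hc₀)
          (by rw [sub_add_cancel, neg_one_mul]; exact hc₁) D₁ D₂
      rw [neg_one_mul, neg_one_mul] at this
      exact this
    -- With `ℓ` chosen as `Z - S C₁ C₂`, the formula for `Z` is immediate and its content moves to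
    -- `hlim`, which identifies `ℓ` with the limit of the weight sums.
    refine ⟨hcont, differentiableOn_lst hWm hW0, C₁, C₂, fun s => Z s - S C₁ C₂ s, ?_, ?_, hc₀, hc₁,
      fun s hs => ⟨hlim s hs, hsumS s hs, (sub_add_cancel _ _).symm⟩, hsys, ?_⟩
    · intro s hs
      have e := hsol s hs
      rw [mul_balance_eq] at e
      linear_combination e
    · intro s hs
      exact hin.negTransform_eq ha₀.1 ha₁.1 hl₀ hl₁ hWm hW0 hst.indep hs
    · rintro a rfl rfl Q R
      have hQ : ∀ s n, pathSum a₁ a₁ h₀ h₁ (fun _ => 1) n s = Q s n := by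
        intro s n
        rw [pathSum_eq_prod, one_mul]
      have hLQ : ∀ D₁ D₂ s n, pathSum a₁ a₁ h₀ h₁ (L D₁ D₂) n s
          = L D₁ D₂ ((a₁ : ℂ) ^ n * s) * Q s n := fun D₁ D₂ s n => pathSum_eq_prod _ _ _
      have hRS : R = S := by
        funext D₁ D₂ s
        exact tsum_congr fun n => (hLQ D₁ D₂ s n).symm
      rw [hRS]
      refine ⟨fun s hs => ⟨(hlim s hs).congr (hQ s), fun D₁ D₂ => (hsumS s hs D₁ D₂).congr
        (hLQ D₁ D₂ s), (sub_add_cancel _ _).symm⟩, hsys⟩
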